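/- Let $d\ge 1$, let $\|\cdot\|$ be a norm on $\mathbb R^d$ and let $\Theta_+^{d-1}=\{\omega\in\mathbb R_+^d:\|\omega\|=1\}$, where $\mathbb R_+=[0,\infty)$. For $\alpha>0$ let $\nu_\alpha$ be the measure on $(0,\infty]$ with ${\rm d}\nu_\alpha(x)=\alpha x^{-\alpha-1}\,{\rm d}x$ (and no mass at $\infty$). Let $\boldsymbol X$ be a random vector in $\mathbb R_+^d$ and $b_n\to\infty$ a sequence. A finite Borel measure $H$ on $\Theta_+^{d-1}$ is called the angular measure of $\boldsymbol X$, with index $\alpha$ and normalising sequence $(b_n)$, if - there is a Radon measure $\nu_{\boldsymbol X}$ on $[0,\infty]^d\setminus\{\boldsymbol 0\}$ (the exponent measure) such that $n\,\mathbb P(\boldsymbol X/b_n\in\cdot)\to\nu_{\boldsymbol X}$ vaguely on $[0,\infty]^d\setminus\{\boldsymbol 0\}$, and $H(C)=\nu_{\boldsymbol X}(\{\boldsymbol x\in\mathbb R_+^d\setminus\{\boldsymbol 0\}:\|\boldsymbol x\|\ge 1,\ \boldsymbol x/\|\boldsymbol x\|\in C\})$ for all Borel sets $C\subseteq\Theta_+^{d-1}$;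 and - $n\,\mathbb P\big((\|\boldsymbol X\|/b_n,\ \boldsymbol X/\|\boldsymbol X\|)\in\cdot\big)\to\nu_\alpha\times H$ vaguely on $(0,\infty]\times\Theta_+^{d-1}$. The vector $\boldsymbol X$ is called multivariate regularly varying with index $\alpha$, written $\boldsymbol X\in{\rm RV}_+^d(\alpha)$, if for every norm on $\mathbb R^d$ it has a non-zero angular measure with index $\alpha$ and some normalising sequence $b_n\to\infty$. **Proposition.** Let $A\in\mathbb R_+^{d\times d}$ have columns $\boldsymbol a_1,\dots,\boldsymbol a_d$, and let $\boldsymbol Z\in{\rm RV}_+^d(\alpha)$, $\alpha>0$, have independent components that are standardised: for every $i\in\{1,\dots,d\}$ and every $z>0$, $n\,\mathbb P(n^{-1/\alpha}Z_i>z)\to z^{-\alpha}$ as $n\to\infty$. Then: 1. If $A\neq 0$, the vector $A\boldsymbol Z$ is multivariate regularly varying with index $\alpha$. 2. For every norm $\|\cdot\|$ on $\mathbb R^d$, the angular measure of $A\boldsymbol Z$ on $\Theta_+^{d-1}$, with index $\alpha$ and normalising sequence $b_n=n^{1/\alpha}$, exists, is unique, and equals $$H_{A\boldsymbol Z}(\cdot)=\sum_{j=1}^d\|\boldsymbol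 a_j\|^\alpha\,\delta_{\boldsymbol a_j/\|\boldsymbol a_j\|}(\cdot),$$ where the terms with $\boldsymbol a_j=\boldsymbol 0$ are read as $0$. (For $A=0$ the angular measure is the zero measure.) -/

import Mathlib

open MeasureTheory ProbabilityTheory Filter Topology
open scoped NNReal ENNReal Matrix

noncomputable section

namespace MRV

/-- Vague convergence of measures on a (locally compact) space: convergence of the integrals of
all continuous compactly supported functions. -/
def VagueTendsto {E : Type*} [TopologicalSpace E] [MeasurableSpace E]
    (μ : ℕ → Measure E) (ν : Measure E) : Prop :=
  ∀ f : E → ℝ, Continuous f → HasCompactSupport f →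
    Tendsto (fun n => ∫ x, f x ∂(μ n)) atTop (𝓝 (∫ x, f x ∂ν))

/-- The punctured compactified orthant `[0, ∞]^d \ {0}`. -/
abbrev Punctured (d : ℕ) : Type := {x : Fin d → ℝ≥0∞ // x ≠ 0}

/-- The half line `(0, ∞]`. -/
abbrev PosExt : Type := {r : ℝ≥0∞ // 0 < r}

/-- `N` is a norm on `ℝ^d` (a seminorm that is definite). -/
def IsNorm {d : ℕ} (N : Seminorm ℝ (Fin d → ℝ)) : Prop := ∀ x, N x = 0 → x = 0

/-- The norm of a vector of the orthant `ℝ_+^d`, as a non-negative real number. -/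
def posNorm {d : ℕ} (N : Seminorm ℝ (Fin d → ℝ)) (x : Fin d → ℝ≥0) : ℝ≥0 :=
  ⟨N (fun i => (x i : ℝ)), apply_nonneg N _⟩

/-- The positive unit sphere `{ω ∈ ℝ_+^d : ‖ω‖ = 1}`. -/
abbrev PosSphere {d : ℕ} (N : Seminorm ℝ (Fin d → ℝ)) : Type :=
  {θ : Fin d → ℝ≥0 // posNorm N θ = 1}

/-- The measure `ν_α` on `(0, ∞]` with `dν_α(x) = α x^(-α-1) dx`, without mass at `∞`. -/
def powerMeasure (α : ℝ) : Measure PosExt :=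
  ((((volume : Measure ℝ).restrict (Set.Ioi 0)).withDensity
    fun x => ENNReal.ofReal (α * x ^ (-α - 1))).map ENNReal.ofReal).comap Subtype.val

/-- `n P(X / b_n ∈ ·)` as a measure on `[0, ∞]^d \ {0}`. -/
def scaledLaw {Ω : Type*} [MeasurableSpace Ω] {d : ℕ} (P : Measure Ω) (X : Ω → Fin d → ℝ≥0)
    (b : ℕ → ℝ≥0) (n : ℕ) : Measure (Punctured d) :=
  (n : ℝ≥0∞) •
    (P.map fun ω => fun i => ((X ω i / b n : ℝ≥0) : ℝ≥0∞)).comap Subtype.val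

/-- `n P((R / b_n, ω) ∈ ·)` as a measure on `(0, ∞] × Θ`, where `R = ‖X‖` and `ω = X / ‖X‖`.
The event `X = 0`, where the angle is undefined, has `R = 0` and does not contribute. -/
def scaledPolarLaw {Ω : Type*} [MeasurableSpace Ω] {d : ℕ} (P : Measure Ω)
    (N : Seminorm ℝ (Fin d → ℝ)) (X : Ω → Fin d → ℝ≥0)
    (b : ℕ → ℝ≥0) (n : ℕ) : Measure (PosExt × PosSphere N) :=
  (n : ℝ≥0∞) •
    (P.map fun ω => (((posNorm N (X ω) / b n : ℝ≥0) : ℝ≥0∞),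
      (posNorm N (X ω))⁻¹ • X ω)).comap (Prod.map Subtype.val Subtype.val)

/-- `ν` is the exponent measure of `X` for the normalising sequence `b`: a Radon measure on
`[0, ∞]^d \ {0}` that is the vague limit of `n P(X / b_n ∈ ·)`. -/
def HasExponentMeasure {Ω : Type*} [MeasurableSpace Ω] {d : ℕ} (P : Measure Ω)
    (X : Ω → Fin d → ℝ≥0) (b : ℕ → ℝ≥0) (ν : Measure (Punctured d)) : Prop :=
  IsFiniteMeasureOnCompacts ν ∧ VagueTendsto (scaledLaw P X b) ν

/-- The set `{x ∈ ℝ_+^d \ {0} : ‖x‖ ≥ 1, x / ‖x‖ ∈ C}`, as a subset of `[0, ∞]^d \ {0}`. -/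
def outerCone {d : ℕ} (N : Seminorm ℝ (Fin d → ℝ)) (C : Set (PosSphere N)) :
    Set (Punctured d) :=
  {x | ∃ y : Fin d → ℝ≥0, (∀ i, x.1 i = (y i : ℝ≥0∞)) ∧ 1 ≤ posNorm N y ∧
    ∃ θ ∈ C, θ.1 = (posNorm N y)⁻¹ • y}

/-- `H` is the angular measure of `X` on the positive unit sphere of `N`, for the index `α` and the
normalising sequence `b_n → ∞`: it is a finite measure with `H(C) = ν({‖x‖ ≥ 1, x/‖x‖ ∈ C})`
for the exponent measure `ν` of `X`, and `n P((R / b_n, ω) ∈ ·)` tends vaguely to `ν_α × H`. -/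
def HasAngularMeasure {Ω : Type*} [MeasurableSpace Ω] {d : ℕ} (P : Measure Ω)
    (N : Seminorm ℝ (Fin d → ℝ)) (X : Ω → Fin d → ℝ≥0) (α : ℝ) (b : ℕ → ℝ≥0)
    (H : Measure (PosSphere N)) : Prop :=
  Tendsto b atTop atTop ∧ IsFiniteMeasure H ∧
  (∃ ν : Measure (Punctured d), HasExponentMeasure P X b ν ∧
    ∀ C : Set (PosSphere N), MeasurableSet C → H C = ν (outerCone N C)) ∧
  VagueTendsto (scaledPolarLaw P N X b) ((powerMeasure α).prod H)

/-- `X ∈ RV_+^d(α)`: for every norm there are a normalising sequence and a non-zero angular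
measure. (With a zero limit allowed, every random vector would qualify.) -/
def IsRegularlyVarying {Ω : Type*} [MeasurableSpace Ω] {d : ℕ} (P : Measure Ω)
    (X : Ω → Fin d → ℝ≥0) (α : ℝ) : Prop :=
  0 < α ∧ ∀ N : Seminorm ℝ (Fin d → ℝ), IsNorm N →
    ∃ (b : ℕ → ℝ≥0) (H : Measure (PosSphere N)), H ≠ 0 ∧ HasAngularMeasure P N X α b H

/-- Standardised components: `n P(n^(-1/α) Z_i > z) → z^(-α)` for all `z > 0` and all `i`. -/
def IsStandardised {Ω : Type*} [MeasurableSpace Ω] {d : ℕ} (P : Measure Ω)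
    (Z : Ω → Fin d → ℝ≥0) (α : ℝ) : Prop :=
  ∀ i : Fin d, ∀ z : ℝ, 0 < z →
    Tendsto (fun n : ℕ => (n : ℝ) * P.real {ω | z < (n : ℝ) ^ (-(1 / α)) * (Z ω i : ℝ)})
      atTop (𝓝 (z ^ (-α)))

/-- The discrete measure `∑_j ‖a_j‖^α δ_{a_j / ‖a_j‖}` on the positive unit sphere, with `a_j` the
`j`-th column of `A`. A zero column has weight `0 ^ α = 0`. -/
def columnAngularMeasure {d : ℕ} (N : Seminorm ℝ (Fin d → ℝ))
    (A : Matrix (Fin d) (Fin d) ℝ≥0) (α : ℝ) : Measure (PosSphere N) :=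
  (∑ j : Fin d, ((posNorm N (fun i => A i j) ^ α : ℝ≥0) : ℝ≥0∞) •
    Measure.dirac ((posNorm N (fun i => A i j))⁻¹ • (fun i => A i j))).comap Subtype.val

end MRV

end

/-! One big jump. Each coordinate of `Z` exceeds a multiple of `n ^ (1 / α)` with probability of
order `1 / n`, so by independence two of them do so together with probability of order `1 / n ^ 2`,
which the factor `n` does not rescue. Hence, for a bounded continuous `F` vanishing near the origin,
`n E F(Z / n ^ (1 / α))` behaves like the sum over `j` of the same expression with every coordinate
but the `j`-th set to zero (`one_big_jump_bound`, `tendsto_integral_of_iIndepFun`); each summand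
converges by the one-dimensional tail condition (`tendsto_integral_of_tendsto_Ioi`).

Taking `F = G ∘ A` sends the axes to the rays through the columns of `A`
(`tendsto_integral_mulVec`). Test functions in Cartesian or polar coordinates, extended by zero, are
both of the form `G`, so this one limit yields both vague convergences. Homogeneity of the power
measure turns the ray through `a_j` into the weight `‖a_j‖ ^ α`. Uniqueness follows by testing the
polar limit against products of a radial and an angular function. -/

namespace MRV

/-! ### The power measure on the half line -/

/-- The measure with density `α x ^ (-α - 1)` on the half line, as a measure on `ℝ≥0`. -/
noncomputable def tailMeasure (α : ℝ) : Measure ℝ≥0 :=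
  (((volume : Measure ℝ).restrict (Set.Ioi 0)).withDensity
    fun x => ENNReal.ofReal (α * x ^ (-α - 1))).map Real.toNNReal

instance (α : ℝ) : SFinite (tailMeasure α) := by
  unfold tailMeasure; infer_instance

lemma measurable_tail_density (α : ℝ) :
    Measurable fun x : ℝ => ENNReal.ofReal (α * x ^ (-α - 1)) := by fun_prop

lemma powerMeasure_eq (α : ℝ) :
    powerMeasure α = ((tailMeasure α).map ((↑) : ℝ≥0 → ℝ≥0∞)).comap Subtype.val := by
  unfold powerMeasure tailMeasure
  rw [Measure.map_map (by fun_prop) (by fun_prop)]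
  rfl

lemma lintegral_tail_density {α : ℝ} (hα : 0 < α) {z : ℝ} (hz : 0 < z) :
    ∫⁻ x in Set.Ioi z, ENNReal.ofReal (α * x ^ (-α - 1)) = ENNReal.ofReal (z ^ (-α)) := by
  rw [← ofReal_integral_eq_lintegral_ofReal]
  · rw [integral_const_mul, integral_Ioi_rpow_of_lt (by linarith) hz]
    congr 1
    rw [show -α - 1 + 1 = -α by ring]
    field_simp
  · exact (integrableOn_Ioi_rpow_of_lt (by linarith) hz).const_mul _
  · filter_upwards [ae_restrict_mem measurableSet_Ioi] with x hx
    have : 0 < x := hz.trans hx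
    positivity

lemma tailMeasure_Ici {α : ℝ} (hα : 0 < α) {z : ℝ≥0} (hz : 0 < z) :
    tailMeasure α (Set.Ici z) = ENNReal.ofReal ((z : ℝ) ^ (-α)) := by
  have hz' : (0 : ℝ) < z := hz
  rw [tailMeasure, Measure.map_apply (by fun_prop) measurableSet_Ici]
  have : Real.toNNReal ⁻¹' Set.Ici z = Set.Ici (z : ℝ) := by
    ext x; simp [Real.le_toNNReal_iff_coe_le' hz]
  rw [this, withDensity_apply _ measurableSet_Ici, Measure.restrict_restrict measurableSet_Ici,
    Set.inter_eq_left.2 (Set.Ici_subset_Ioi.2 hz'), setLIntegral_congr Ioi_ae_eq_Ici.symm,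
    lintegral_tail_density hα hz']

lemma tailMeasure_Ioi {α : ℝ} (hα : 0 < α) {z : ℝ≥0} (hz : 0 < z) :
    tailMeasure α (Set.Ioi z) = ENNReal.ofReal ((z : ℝ) ^ (-α)) := by
  have hz' : (0 : ℝ) < z := hz
  rw [tailMeasure, Measure.map_apply (by fun_prop) measurableSet_Ioi]
  have : Real.toNNReal ⁻¹' Set.Ioi z = Set.Ioi (z : ℝ) := by
    ext x; simp [Real.lt_toNNReal_iff_coe_lt]
  rw [this, withDensity_apply _ measurableSet_Ioi, Measure.restrict_restrict measurableSet_Ioi,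
    Set.inter_eq_left.2 (Set.Ioi_subset_Ioi hz'.le), lintegral_tail_density hα hz']

lemma tailMeasure_Ioi_ne_top {α : ℝ} (hα : 0 < α) {z : ℝ≥0} (hz : 0 < z) :
    tailMeasure α (Set.Ioi z) ≠ ∞ := by simp [tailMeasure_Ioi hα hz]

lemma tailMeasure_real_Ioi {α : ℝ} (hα : 0 < α) {z : ℝ≥0} (hz : 0 < z) :
    (tailMeasure α).real (Set.Ioi z) = (z : ℝ) ^ (-α) := by
  rw [measureReal_def, tailMeasure_Ioi hα hz, ENNReal.toReal_ofReal (by positivity)]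

lemma tendsto_tailMeasure_real_Ioi {α : ℝ} (hα : 0 < α) :
    Tendsto (fun z => (tailMeasure α).real (Set.Ioi z)) atTop (𝓝 0) := by
  have : Tendsto (fun z : ℝ≥0 => (z : ℝ) ^ (-α)) atTop (𝓝 0) :=
    (tendsto_rpow_neg_atTop hα).comp (NNReal.tendsto_coe_atTop.2 tendsto_id)
  refine this.congr' ?_
  filter_upwards [eventually_gt_atTop 0] with z hz
  rw [tailMeasure_real_Ioi hα hz]

lemma integral_tailMeasure {α : ℝ} (hα : 0 < α) {g : ℝ≥0 → ℝ} (hg : Measurable g) :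
    ∫ x, g x ∂(tailMeasure α) = ∫ x in Set.Ioi 0, α * x ^ (-α - 1) * g x.toNNReal := by
  rw [tailMeasure, integral_map (by fun_prop) hg.aestronglyMeasurable,
    integral_withDensity_eq_integral_toReal_smul (measurable_tail_density α) (by simp)]
  refine setIntegral_congr_fun measurableSet_Ioi fun x hx => ?_
  have : (0 : ℝ) < x := hx
  simp only [smul_eq_mul]
  rw [ENNReal.toReal_ofReal (by positivity)]

/-- Scaling property of the power measure. -/
lemma integral_tailMeasure_comp_mul {α : ℝ} (hα : 0 < α) {g : ℝ≥0 → ℝ} (hg : Measurable g)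
    {c : ℝ≥0} (hc : 0 < c) :
    ∫ x, g (c * x) ∂(tailMeasure α) = (c : ℝ) ^ α * ∫ x, g x ∂(tailMeasure α) := by
  have hc' : (0 : ℝ) < c := hc
  rw [integral_tailMeasure hα hg, integral_tailMeasure hα (by fun_prop)]
  have h := integral_comp_mul_left_Ioi (fun x : ℝ => α * x ^ (-α - 1) * g x.toNNReal) 0 hc'
  rw [mul_zero, smul_eq_mul] at h
  -- The density at `x` is `c ^ (α + 1)` times the density at `c * x`; the substitution costs one
  -- factor `c`, which leaves `c ^ α`.
  have h2 : ∫ x in Set.Ioi (0 : ℝ), α * x ^ (-α - 1) * g (c * x.toNNReal) =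
      ∫ x in Set.Ioi (0 : ℝ), (c : ℝ) ^ (α + 1) *
        (α * ((c : ℝ) * x) ^ (-α - 1) * g ((c : ℝ) * x).toNNReal) := by
    refine setIntegral_congr_fun measurableSet_Ioi fun x hx => ?_
    have hx' : (0 : ℝ) < x := hx
    have e1 : ((c : ℝ) * x).toNNReal = c * x.toNNReal := by
      rw [Real.toNNReal_mul c.coe_nonneg, Real.toNNReal_coe]
    have e2 : (c : ℝ) ^ (α + 1) * (c : ℝ) ^ (-α - 1) = 1 := by
      rw [← Real.rpow_add hc']; simp
    simp only [e1]
    rw [Real.mul_rpow hc'.le hx'.le]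
    linear_combination (-(α * x ^ (-α - 1) * g (c * x.toNNReal))) * e2
  rw [h2, integral_const_mul, h, ← mul_assoc, Real.rpow_add hc', Real.rpow_one]
  field_simp

/-! ### From convergence of tails to convergence of integrals -/

/-- A sequence converges if it can be approximated by convergent sequences, with an error that is
dominated by sequences with small limits. -/
lemma tendsto_of_forall_approx {u : ℕ → ℝ} {l : ℝ}
    (h : ∀ κ > 0, ∃ (v w : ℕ → ℝ) (a b : ℝ), Tendsto v atTop (𝓝 a) ∧ Tendsto w atTop (𝓝 b) ∧
      (∀ n, |u n - v n| ≤ w n) ∧ |l - a| ≤ κ ∧ b ≤ κ) :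
    Tendsto u atTop (𝓝 l) := by
  rw [Metric.tendsto_atTop']
  intro κ hκ
  -- Eventually `|u - v| ≤ w < κ / 2` and `|v - a| < κ / 4`, while `|a - l| ≤ κ / 4`.
  obtain ⟨v, w, a, b, hv, hw, huv, hla, hb⟩ := h (κ / 4) (by positivity)
  have e1 := (Metric.tendsto_nhds.1 hv) (κ / 4) (by positivity)
  have e2 := hw.eventually_lt_const (show b < κ / 2 by linarith)
  obtain ⟨n, hn⟩ := eventually_atTop.1 (e1.and e2)
  refine ⟨n, fun m hm => ?_⟩
  obtain ⟨h1, h2⟩ := hn m hm.le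
  have h3 := huv m
  rw [Real.dist_eq] at *
  rw [abs_lt] at *
  rw [abs_le] at *
  constructor <;> linarith

/-- Convergence of the tails on `(0, ∞)` implies convergence of the integrals of bounded continuous
functions that vanish near `0`. -/
lemma tendsto_integral_of_tendsto_Ioi {μ : ℕ → Measure ℝ≥0} [∀ n, IsFiniteMeasure (μ n)]
    {ν : Measure ℝ≥0} (hν : ∀ z : ℝ≥0, 0 < z → ν (Set.Ioi z) ≠ ∞)
    (h : ∀ z : ℝ≥0, 0 < z →
      Tendsto (fun n => (μ n).real (Set.Ioi z)) atTop (𝓝 (ν.real (Set.Ioi z))))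
    (h0 : Tendsto (fun z => ν.real (Set.Ioi z)) atTop (𝓝 0))
    {g : ℝ≥0 → ℝ} (hg : Continuous g) {C : ℝ} (hC : ∀ x, |g x| ≤ C) {ε : ℝ≥0} (hε : 0 < ε)
    (hgε : ∀ x ≤ ε, g x = 0) :
    Tendsto (fun n => ∫ x, g x ∂(μ n)) atTop (𝓝 (∫ x, g x ∂ν)) := by
  have hC0 : 0 ≤ C := (abs_nonneg _).trans (hC 0)
  apply tendsto_of_forall_approx
  intro κ hκ
  -- `M` makes the mass beyond it negligible; `η` is the oscillation of `g` tolerated on each grid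
  -- cell up to `M`, where the mass is at most that of `(ε, ∞)`.
  obtain ⟨M, hM, hεM⟩ : ∃ M, 2 * C * ν.real (Set.Ioi M) < κ / 2 ∧ ε < M := by
    have h1 : Tendsto (fun z => 2 * C * ν.real (Set.Ioi z)) atTop (𝓝 0) := by
      simpa using h0.const_mul (2 * C)
    exact ((h1.eventually_lt_const (show 0 < κ / 2 by positivity)).and
      (eventually_gt_atTop ε)).exists
  obtain ⟨η, hη, hηκ⟩ : ∃ η > 0, η * ν.real (Set.Ioi ε) < κ / 2 := by
    have h1 : Tendsto (fun η : ℝ => η * ν.real (Set.Ioi ε)) (𝓝[>] 0) (𝓝 0) := by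
      have : Tendsto (fun η : ℝ => η * ν.real (Set.Ioi ε)) (𝓝 0) (𝓝 (0 * _)) :=
        tendsto_id.mul_const _
      rw [zero_mul] at this
      exact this.mono_left nhdsWithin_le_nhds
    obtain ⟨η, h2, h3⟩ := ((h1.eventually_lt_const (show 0 < κ / 2 by positivity)).and
      self_mem_nhdsWithin).exists
    exact ⟨η, h3, h2⟩
  obtain ⟨δ, hδ, hδg⟩ := Metric.uniformContinuousOn_iff.1
    (isCompact_Icc.uniformContinuousOn_of_continuous (hg.continuousOn (s := Set.Icc 0 M))) η hη
  obtain ⟨s, hs, hsδ⟩ : ∃ s : ℝ≥0, 0 < s ∧ (s : ℝ) < δ :=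
    ⟨(δ / 2).toNNReal, by simpa using hδ, by rw [Real.coe_toNNReal _ (by positivity)]; linarith⟩
  obtain ⟨K, hK⟩ : ∃ K : ℕ, M ≤ ε + K * s := by
    obtain ⟨K, hK⟩ := Archimedean.arch M hs
    exact ⟨K, by rw [nsmul_eq_mul] at hK; exact hK.trans (by simp)⟩
  set t : ℕ → ℝ≥0 := fun k => ε + k * s with ht
  have htpos : ∀ k, 0 < t k := fun k => by positivity
  have htmono : Monotone t := fun i j hij => by simp only [ht]; gcongr
  -- `S` samples `g` at the left end of each cell `(t k, t (k + 1)]`. Cell indicators are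
  -- differences of tail indicators, so the integral of `S` involves tails only.
  set S : ℝ≥0 → ℝ := fun x => ∑ k ∈ Finset.range K,
    g (t k) * ((Set.Ioi (t k)).indicator 1 x - (Set.Ioi (t (k + 1))).indicator 1 x) with hS
  set R : ℝ≥0 → ℝ := fun x =>
    η * (Set.Ioi ε).indicator 1 x + 2 * C * (Set.Ioi M).indicator 1 x with hR
  have hbound : ∀ x, |g x - S x| ≤ R x := by
    intro x
    have hR0 : 0 ≤ R x := by
      have h1 : 0 ≤ (Set.Ioi ε).indicator (1 : ℝ≥0 → ℝ) x :=
        Set.indicator_nonneg (fun _ _ => zero_le_one) _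
      have h2 : 0 ≤ (Set.Ioi M).indicator (1 : ℝ≥0 → ℝ) x :=
        Set.indicator_nonneg (fun _ _ => zero_le_one) _
      simp only [hR]; positivity
    by_cases hx : x ≤ ε
    · have : S x = 0 := Finset.sum_eq_zero fun k _ => by
        have h1 : ¬ t k < x := not_lt.2 (hx.trans (by simp [ht]))
        have h2 : ¬ t (k + 1) < x := not_lt.2 (hx.trans (by simp [ht]))
        simp [Set.indicator, h1, h2]
      rw [this, hgε x hx]; simpa using hR0
    push Not at hx
    by_cases hxK : t K < x
    · have h1 : S x = 0 := Finset.sum_eq_zero fun k hk => by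
        have h1 : t k < x := (htmono (Finset.mem_range.1 hk).le).trans_lt hxK
        have h2 : t (k + 1) < x := (htmono (Finset.mem_range.1 hk)).trans_lt hxK
        simp [Set.indicator, h1, h2]
      have h2 : M < x := hK.trans_lt hxK
      simp only [h1, hR, Set.indicator, Set.mem_Ioi, hx, h2, if_true, Pi.one_apply, sub_zero,
        mul_one]
      linarith [hC x]
    -- The least `k` with `x ≤ t k` is positive since `ε < x`; its predecessor indexes the cell
    -- containing `x`.
    have hex : ∃ k, x ≤ t k := ⟨K, not_lt.1 hxK⟩
    have hfind : Nat.find hex ≠ 0 := by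
      intro h1
      have := Nat.find_spec hex
      rw [h1] at this
      simp only [ht, Nat.cast_zero, zero_mul, add_zero] at this
      exact absurd this (not_le.2 hx)
    obtain ⟨k, hk⟩ := Nat.exists_eq_succ_of_ne_zero hfind
    have hxk1 : x ≤ t (k + 1) := by have := Nat.find_spec hex; rwa [hk] at this
    have hxk : t k < x := not_le.1 (Nat.find_min hex (by omega))
    have hkK : k < K := by
      have := Nat.find_min' hex (not_lt.1 hxK)
      omega
    have hSx : S x = g (t k) := by
      simp only [hS]
      rw [Finset.sum_eq_single k]
      · simp [Set.indicator, hxk, not_lt.2 hxk1]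
      · intro j _ hjk
        rcases lt_or_gt_of_ne hjk with hj | hj
        · have h1 : t j < x := (htmono hj.le).trans_lt hxk
          have h2 : t (j + 1) < x := (htmono hj).trans_lt hxk
          simp [Set.indicator, h1, h2]
        · have h1 : ¬ t j < x := not_lt.2 (hxk1.trans (htmono hj))
          have h2 : ¬ t (j + 1) < x := not_lt.2 (hxk1.trans (htmono (by omega)))
          simp [Set.indicator, h1, h2]
      · intro h1; exact absurd (Finset.mem_range.2 hkK) h1
    rw [hSx]
    by_cases hxM : M < x
    · simp only [hR, Set.indicator, Set.mem_Ioi, hx, hxM, if_true, Pi.one_apply, mul_one]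
      have := abs_sub (g x) (g (t k))
      linarith [hC x, hC (t k)]
    · have hd : dist x (t k) < δ := by
        rw [NNReal.dist_eq, abs_of_nonneg (by simpa using hxk.le)]
        have : (x : ℝ) ≤ t k + s := by
          have h1 : x ≤ t k + s := hxk1.trans (by simp only [ht]; push_cast; ring_nf; rfl)
          exact_mod_cast h1
        linarith
      have := hδg x ⟨zero_le, not_lt.1 hxM⟩ (t k)
        ⟨zero_le, hxk.le.trans (not_lt.1 hxM)⟩ hd
      rw [Real.dist_eq] at this
      simp only [hR, Set.indicator, Set.mem_Ioi, hx, hxM, if_true, if_false, Pi.one_apply]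
      linarith
  have hint : ∀ (m : Measure ℝ≥0), (∀ z : ℝ≥0, 0 < z → m (Set.Ioi z) ≠ ∞) → ∀ z : ℝ≥0, 0 < z →
      Integrable ((Set.Ioi z).indicator (1 : ℝ≥0 → ℝ)) m := fun m hm z hz =>
    (integrable_indicator_iff measurableSet_Ioi).2 (integrableOn_const (hm z hz))
  have hSint : ∀ (m : Measure ℝ≥0), (∀ z : ℝ≥0, 0 < z → m (Set.Ioi z) ≠ ∞) → Integrable S m :=
    fun m hm => integrable_finsetSum _ fun k _ =>
      ((hint m hm _ (htpos _)).sub (hint m hm _ (htpos _))).const_mul _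
  have hRint : ∀ (m : Measure ℝ≥0), (∀ z : ℝ≥0, 0 < z → m (Set.Ioi z) ≠ ∞) → Integrable R m :=
    fun m hm => ((hint m hm _ hε).const_mul _).add ((hint m hm _ (hε.trans hεM)).const_mul _)
  have hSI : ∀ (m : Measure ℝ≥0), (∀ z : ℝ≥0, 0 < z → m (Set.Ioi z) ≠ ∞) →
      ∫ x, S x ∂m = ∑ k ∈ Finset.range K,
        g (t k) * (m.real (Set.Ioi (t k)) - m.real (Set.Ioi (t (k + 1)))) := fun m hm => by
    simp only [hS]
    rw [integral_finsetSum]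
    swap
    · exact fun k _ => ((hint m hm _ (htpos _)).sub (hint m hm _ (htpos _))).const_mul _
    refine Finset.sum_congr rfl fun k _ => ?_
    rw [integral_const_mul, integral_sub (hint m hm _ (htpos _)) (hint m hm _ (htpos _)),
      integral_indicator_one measurableSet_Ioi, integral_indicator_one measurableSet_Ioi]
  have hRI : ∀ (m : Measure ℝ≥0), (∀ z : ℝ≥0, 0 < z → m (Set.Ioi z) ≠ ∞) →
      ∫ x, R x ∂m = η * m.real (Set.Ioi ε) + 2 * C * m.real (Set.Ioi M) := fun m hm => by
    simp only [hR]
    rw [integral_add ((hint m hm _ hε).const_mul _) ((hint m hm _ (hε.trans hεM)).const_mul _),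
      integral_const_mul, integral_const_mul,
      integral_indicator_one measurableSet_Ioi, integral_indicator_one measurableSet_Ioi]
  have hdiff : ∀ (m : Measure ℝ≥0), (∀ z : ℝ≥0, 0 < z → m (Set.Ioi z) ≠ ∞) →
      |∫ x, g x ∂m - ∫ x, S x ∂m| ≤ ∫ x, R x ∂m := fun m hm => by
    -- The measure `m` may be infinite near `0`, so integrability of `g` comes from that of `S` and
    -- the bound `R` on the difference.
    have hgi : Integrable g m := by
      have : Integrable (fun x => g x - S x) m := by
        refine (hRint m hm).mono' ?_ (Eventually.of_forall hbound)
        exact hg.aestronglyMeasurable.sub (hSint m hm).aestronglyMeasurable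
      convert! this.add (hSint m hm) using 1
      ext x; simp
    rw [← integral_sub hgi (hSint m hm)]
    exact (abs_integral_le_integral_abs).trans
      (integral_mono (hgi.sub (hSint m hm)).abs (hRint m hm) hbound)
  have hμ : ∀ n, ∀ z : ℝ≥0, 0 < z → μ n (Set.Ioi z) ≠ ∞ := fun n z _ => measure_ne_top _ _
  refine ⟨fun n => ∫ x, S x ∂(μ n), fun n => ∫ x, R x ∂(μ n), ∫ x, S x ∂ν, ∫ x, R x ∂ν,
    ?_, ?_, fun n => hdiff _ (hμ n), (hdiff ν hν).trans ?_, ?_⟩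
  · simp only [hSI _ (hμ _), hSI ν hν]
    exact tendsto_finsetSum _ fun k _ => ((h _ (htpos _)).sub (h _ (htpos _))).const_mul _
  · simp only [hRI _ (hμ _), hRI ν hν]
    exact ((h _ hε).const_mul _).add ((h _ (hε.trans hεM)).const_mul _)
  · rw [hRI ν hν]; linarith
  · rw [hRI ν hν]; linarith

/-! ### One big jump -/

lemma indicator_one_nonneg {β : Type*} (s : Set β) (x : β) : 0 ≤ s.indicator (1 : β → ℝ) x :=
  Set.indicator_nonneg (fun _ _ => zero_le_one) x

/-- The value of a function at a vector is approximated by the sum of its values at the projections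
to the coordinate axes, except when two coordinates are large. -/
lemma one_big_jump_bound {d : ℕ} {F : (Fin d → ℝ≥0) → ℝ} {C : ℝ} (hC : ∀ z, |F z| ≤ C)
    {ε δ M : ℝ≥0} {η : ℝ} (hδε : δ ≤ ε) (hεM : ε ≤ M) (hη0 : 0 ≤ η)
    (hFε : ∀ z, (∀ i, z i ≤ ε) → F z = 0)
    (hη : ∀ z z' : Fin d → ℝ≥0, (∀ i, z i ≤ M) → (∀ i, z' i ≤ M) →
      (∀ i, dist (z i) (z' i) ≤ δ) → |F z - F z'| ≤ η) (w : Fin d → ℝ≥0) :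
    |F w - ∑ j, F (Pi.single j (w j))| ≤
      ∑ j, (η * (Set.Ioi ε).indicator 1 (w j) + 2 * C * (Set.Ioi M).indicator 1 (w j)) +
      (d + 1) * C * ∑ i, ∑ j ∈ Finset.univ.erase i,
        (Set.Ioi δ).indicator 1 (w i) * (Set.Ioi δ).indicator 1 (w j) := by
  have hC0 : 0 ≤ C := (abs_nonneg _).trans (hC 0)
  have hA0 : ∀ j, 0 ≤ η * (Set.Ioi ε).indicator (1 : ℝ≥0 → ℝ) (w j) +
      2 * C * (Set.Ioi M).indicator 1 (w j) := fun j => by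
    have := indicator_one_nonneg (Set.Ioi ε) (w j)
    have := indicator_one_nonneg (Set.Ioi M) (w j)
    positivity
  have hB0 : ∀ i j, 0 ≤ (Set.Ioi δ).indicator (1 : ℝ≥0 → ℝ) (w i) *
      (Set.Ioi δ).indicator 1 (w j) := fun i j =>
    mul_nonneg (indicator_one_nonneg _ _) (indicator_one_nonneg _ _)
  have hBs : 0 ≤ (d + 1) * C * ∑ i, ∑ j ∈ Finset.univ.erase i,
      (Set.Ioi δ).indicator (1 : ℝ≥0 → ℝ) (w i) * (Set.Ioi δ).indicator 1 (w j) :=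
    mul_nonneg (by positivity) (Finset.sum_nonneg fun i _ => Finset.sum_nonneg fun j _ => hB0 i j)
  have hAs : 0 ≤ ∑ j, (η * (Set.Ioi ε).indicator (1 : ℝ≥0 → ℝ) (w j) +
      2 * C * (Set.Ioi M).indicator 1 (w j)) := Finset.sum_nonneg fun j _ => hA0 j
  -- With two coordinates above `δ` the pair sum is at least `1`, which pays for the trivial bound
  -- on `d + 1` values of `F`.
  by_cases h2 : ∃ i j, j ≠ i ∧ δ < w i ∧ δ < w j
  · obtain ⟨i, j, hij, hi, hj⟩ := h2
    have h1 : 1 ≤ ∑ i, ∑ j ∈ Finset.univ.erase i,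
        (Set.Ioi δ).indicator (1 : ℝ≥0 → ℝ) (w i) * (Set.Ioi δ).indicator 1 (w j) := by
      calc (1 : ℝ) = (Set.Ioi δ).indicator (1 : ℝ≥0 → ℝ) (w i) *
            (Set.Ioi δ).indicator 1 (w j) := by simp [Set.indicator, hi, hj]
        _ ≤ ∑ j ∈ Finset.univ.erase i,
            (Set.Ioi δ).indicator (1 : ℝ≥0 → ℝ) (w i) * (Set.Ioi δ).indicator 1 (w j) :=
          Finset.single_le_sum (f := fun j => (Set.Ioi δ).indicator (1 : ℝ≥0 → ℝ) (w i) *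
            (Set.Ioi δ).indicator 1 (w j)) (fun j _ => hB0 i j)
            (Finset.mem_erase.2 ⟨hij, Finset.mem_univ j⟩)
        _ ≤ _ := Finset.single_le_sum (f := fun i => ∑ j ∈ Finset.univ.erase i,
            (Set.Ioi δ).indicator (1 : ℝ≥0 → ℝ) (w i) * (Set.Ioi δ).indicator 1 (w j))
            (fun i _ => Finset.sum_nonneg fun j _ => hB0 i j) (Finset.mem_univ i)
    have h3 : |F w - ∑ j, F (Pi.single j (w j))| ≤ (d + 1) * C := by
      calc |F w - ∑ j, F (Pi.single j (w j))|
          ≤ |F w| + |∑ j, F (Pi.single j (w j))| := abs_sub _ _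
        _ ≤ C + ∑ j : Fin d, C := by
          gcongr
          · exact hC w
          · exact (Finset.abs_sum_le_sum_abs _ _).trans (Finset.sum_le_sum fun j _ => hC _)
        _ = (d + 1) * C := by simp; ring
    have h4 : (d + 1) * C * 1 ≤ (d + 1) * C * ∑ i, ∑ j ∈ Finset.univ.erase i,
        (Set.Ioi δ).indicator (1 : ℝ≥0 → ℝ) (w i) * (Set.Ioi δ).indicator 1 (w j) := by gcongr
    linarith
  push Not at h2
  have hsingle : ∀ j, w j ≤ ε → F (Pi.single j (w j)) = 0 := fun j hj => hFε _ fun i => by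
    rcases eq_or_ne i j with rfl | hij
    · simpa using hj
    · simp [hij]
  by_cases h3 : ∀ j, w j ≤ ε
  · rw [hFε w h3, Finset.sum_eq_zero fun j _ => hsingle j (h3 j)]
    simp only [sub_zero, abs_zero]
    positivity
  push Not at h3
  obtain ⟨j, hj⟩ := h3
  -- The jump is at `j` alone, so `w` is within `δ` of its projection to the `j`-th axis, and the
  -- projections to the other axes are in the zone where `F` vanishes.
  have hi : ∀ i, i ≠ j → w i ≤ δ := fun i hij => by
    by_contra! h
    exact absurd (h2 i j hij.symm h) (not_le.2 (hδε.trans_lt hj))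
  rw [Finset.sum_eq_single j (fun i _ hij => hsingle i ((hi i hij).trans hδε)) (by simp)]
  have hj' : |F w - F (Pi.single j (w j))| ≤
      η * (Set.Ioi ε).indicator 1 (w j) + 2 * C * (Set.Ioi M).indicator 1 (w j) := by
    by_cases hM : M < w j
    · have := abs_sub (F w) (F (Pi.single j (w j)))
      have := hC w
      have := hC (Pi.single j (w j))
      simp only [Set.indicator, Set.mem_Ioi, hj, hM, if_true, Pi.one_apply]
      linarith
    · have h5 : ∀ i, w i ≤ M := fun i => by
        rcases eq_or_ne i j with rfl | hij
        · exact not_lt.1 hM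
        · exact (hi i hij).trans (hδε.trans hεM)
      have := hη w (Pi.single j (w j)) h5 (fun i => by
        rcases eq_or_ne i j with rfl | hij
        · simpa using h5 i
        · simp [hij]) (fun i => by
        rcases eq_or_ne i j with rfl | hij
        · simp
        · simp only [Pi.single_eq_of_ne hij, NNReal.dist_eq, NNReal.coe_zero, sub_zero,
            NNReal.abs_eq]
          exact_mod_cast hi i hij)
      simp only [Set.indicator, Set.mem_Ioi, hj, hM, if_true, if_false, Pi.one_apply]
      linarith
  have := Finset.single_le_sum (fun j _ => hA0 j) (Finset.mem_univ j)
  linarith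

/-- One big jump: for a triangular array of random vectors with independent components, the scaled
expectations of functions that vanish near the origin are determined by those of the components. -/
lemma tendsto_integral_of_iIndepFun {Ω : Type*} [MeasurableSpace Ω] {P : Measure Ω}
    [IsProbabilityMeasure P] {d : ℕ} {W : ℕ → Ω → Fin d → ℝ≥0} (hW : ∀ n, Measurable (W n))
    (hind : ∀ n, iIndepFun (fun i ω => W n ω i) P) {ν : Measure ℝ≥0}
    (hν : ∀ z : ℝ≥0, 0 < z → ν (Set.Ioi z) ≠ ∞)
    (h : ∀ i, ∀ z : ℝ≥0, 0 < z →
      Tendsto (fun n : ℕ => n * P.real {ω | z < W n ω i}) atTop (𝓝 (ν.real (Set.Ioi z))))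
    (h0 : Tendsto (fun z => ν.real (Set.Ioi z)) atTop (𝓝 0))
    {F : (Fin d → ℝ≥0) → ℝ} (hF : Continuous F) {C : ℝ} (hC : ∀ z, |F z| ≤ C) {ε : ℝ≥0}
    (hε : 0 < ε) (hFε : ∀ z, (∀ i, z i ≤ ε) → F z = 0) :
    Tendsto (fun n : ℕ => n * ∫ ω, F (W n ω) ∂P) atTop
      (𝓝 (∑ j, ∫ x, F (Pi.single j x) ∂ν)) := by
  have hC0 : 0 ≤ C := (abs_nonneg _).trans (hC 0)
  have hWj : ∀ n j, Measurable fun ω => W n ω j := fun n j => measurable_pi_iff.1 (hW n) j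
  have hsingle : ∀ j : Fin d, Continuous fun x : ℝ≥0 => F (Pi.single j x) := fun j =>
    hF.comp (continuous_single (A := fun _ => ℝ≥0) j)
  have h1d : ∀ j, Tendsto (fun n : ℕ => n * ∫ ω, F (Pi.single j (W n ω j)) ∂P) atTop
      (𝓝 (∫ x, F (Pi.single j x) ∂ν)) := fun j => by
    have := tendsto_integral_of_tendsto_Ioi
      (μ := fun n : ℕ => (n : ℝ≥0) • P.map (fun ω => W n ω j)) hν
      (fun z hz => by
        refine (h j z hz).congr fun n => ?_
        rw [measureReal_nnreal_smul_apply, map_measureReal_apply (hWj n j) measurableSet_Ioi]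
        rfl) h0 (hsingle j) (fun x => hC _) hε
      (fun x hx => hFε _ fun i => by
        rcases eq_or_ne i j with rfl | hij
        · simpa using hx
        · simp [hij])
    refine this.congr fun n => ?_
    rw [integral_smul_nnreal_measure, integral_map (hWj n j).aemeasurable
      (hsingle j).aestronglyMeasurable]
    simp [NNReal.smul_def]
  have hindm : ∀ z n j, Measurable fun ω => (Set.Ioi z).indicator (1 : ℝ≥0 → ℝ) (W n ω j) :=
    fun z n j => (measurable_one.indicator measurableSet_Ioi).comp (hWj n j)
  have hind1 : ∀ (z : ℝ≥0) (x : ℝ≥0), ‖(Set.Ioi z).indicator (1 : ℝ≥0 → ℝ) x‖ ≤ 1 := fun z x => by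
    unfold Set.indicator; split_ifs <;> simp
  have hindI : ∀ z n j, Integrable (fun ω => (Set.Ioi z).indicator (1 : ℝ≥0 → ℝ) (W n ω j)) P :=
    fun z n j => Integrable.of_bound (hindm z n j).aestronglyMeasurable 1
      (Eventually.of_forall fun ω => hind1 _ _)
  have hindE : ∀ z n j, ∫ ω, (Set.Ioi z).indicator (1 : ℝ≥0 → ℝ) (W n ω j) ∂P =
      P.real {ω | z < W n ω j} := fun z n j =>
    integral_indicator_one (s := {ω | z < W n ω j}) (hWj n j measurableSet_Ioi)
  have hpairI : ∀ z n i j, Integrable (fun ω => (Set.Ioi z).indicator (1 : ℝ≥0 → ℝ) (W n ω i) *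
      (Set.Ioi z).indicator (1 : ℝ≥0 → ℝ) (W n ω j)) P := fun z n i j =>
    Integrable.of_bound ((hindm z n i).mul (hindm z n j)).aestronglyMeasurable 1
      (Eventually.of_forall fun ω => by
        rw [norm_mul]
        exact mul_le_one₀ (hind1 _ _) (norm_nonneg _) (hind1 _ _))
  have hpairE : ∀ z n i j, j ≠ i → ∫ ω, (Set.Ioi z).indicator (1 : ℝ≥0 → ℝ) (W n ω i) *
      (Set.Ioi z).indicator (1 : ℝ≥0 → ℝ) (W n ω j) ∂P =
      P.real {ω | z < W n ω i} * P.real {ω | z < W n ω j} := fun z n i j hij => by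
    have h1 : IndepFun (fun ω => (Set.Ioi z).indicator (1 : ℝ≥0 → ℝ) (W n ω i))
        (fun ω => (Set.Ioi z).indicator (1 : ℝ≥0 → ℝ) (W n ω j)) P :=
      ((hind n).indepFun hij.symm).comp (measurable_one.indicator measurableSet_Ioi)
        (measurable_one.indicator measurableSet_Ioi)
    rw [h1.integral_fun_mul_eq_mul_integral (hindm z n i).aestronglyMeasurable
      (hindm z n j).aestronglyMeasurable, hindE, hindE]
  -- Since `n * p` converges, `p` tends to `0`; this kills the pair terms `(n * p) * p`.
  have hp0 : ∀ z : ℝ≥0, 0 < z → ∀ j, Tendsto (fun n : ℕ => P.real {ω | z < W n ω j}) atTop (𝓝 0) :=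
    fun z hz j => by
      have h1 := (h j z hz).mul (tendsto_inv_atTop_nhds_zero_nat (𝕜 := ℝ))
      rw [mul_zero] at h1
      refine h1.congr' ?_
      filter_upwards [eventually_gt_atTop 0] with n hn
      field_simp
  apply tendsto_of_forall_approx
  intro κ hκ
  obtain ⟨M, hM, hεM⟩ : ∃ M, d * (2 * C * ν.real (Set.Ioi M)) < κ / 2 ∧ ε < M := by
    have h1 : Tendsto (fun z => d * (2 * C * ν.real (Set.Ioi z))) atTop (𝓝 0) := by
      simpa using (h0.const_mul (2 * C)).const_mul (d : ℝ)
    exact ((h1.eventually_lt_const (show 0 < κ / 2 by positivity)).and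
      (eventually_gt_atTop ε)).exists
  obtain ⟨η, hη, hηκ⟩ : ∃ η > 0, d * (η * ν.real (Set.Ioi ε)) < κ / 2 := by
    have h1 : Tendsto (fun η : ℝ => d * (η * ν.real (Set.Ioi ε))) (𝓝[>] 0) (𝓝 0) := by
      have : Tendsto (fun η : ℝ => d * (η * ν.real (Set.Ioi ε))) (𝓝 0) (𝓝 (d * (0 * _))) :=
        (tendsto_id.mul_const _).const_mul _
      rw [zero_mul, mul_zero] at this
      exact this.mono_left nhdsWithin_le_nhds
    obtain ⟨η, h2, h3⟩ := ((h1.eventually_lt_const (show 0 < κ / 2 by positivity)).and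
      self_mem_nhdsWithin).exists
    exact ⟨η, h3, h2⟩
  -- Uniform continuity holds on the compact box `[0, M]^d`; coordinates beyond `M` are left to the
  -- `2 * C` term.
  obtain ⟨δ', hδ', hδF⟩ := Metric.uniformContinuousOn_iff.1
    (isCompact_Icc.uniformContinuousOn_of_continuous
      (hF.continuousOn (s := Set.Icc 0 (fun _ => M)))) η hη
  obtain ⟨δ, hδ, hδδ, hδε⟩ : ∃ δ : ℝ≥0, 0 < δ ∧ (δ : ℝ) < δ' ∧ δ ≤ ε :=
    ⟨min ε (δ' / 2).toNNReal, lt_min hε (by simpa using hδ'), by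
      rw [NNReal.coe_min, Real.coe_toNNReal _ (by positivity)]
      exact (min_le_right _ _).trans_lt (by linarith), min_le_left _ _⟩
  have hbound := one_big_jump_bound hC hδε hεM.le hη.le hFε (η := η) (fun z z' hz hz' hd => by
    have := hδF z ⟨fun i => zero_le, hz⟩ z' ⟨fun i => zero_le, hz'⟩
      (((dist_pi_le_iff δ.coe_nonneg).2 hd).trans_lt hδδ)
    rw [Real.dist_eq] at this
    exact this.le)
  set p : ℝ≥0 → ℕ → Fin d → ℝ := fun z n j => P.real {ω | z < W n ω j} with hp
  refine ⟨fun n => ∑ j, n * ∫ ω, F (Pi.single j (W n ω j)) ∂P,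
    fun n => ∑ j, (η * (n * p ε n j) + 2 * C * (n * p M n j)) +
      (d + 1) * C * ∑ i, ∑ j ∈ Finset.univ.erase i, (n * p δ n i) * p δ n j,
    ∑ j, ∫ x, F (Pi.single j x) ∂ν,
    ∑ j : Fin d, (η * ν.real (Set.Ioi ε) + 2 * C * ν.real (Set.Ioi M)) +
      (d + 1) * C * ∑ i : Fin d, ∑ j ∈ Finset.univ.erase i, ν.real (Set.Ioi δ) * 0,
    tendsto_finsetSum _ fun j _ => h1d j, ?_, fun n => ?_, ?_, ?_⟩
  · refine (tendsto_finsetSum _ fun j _ => ?_).add ((tendsto_finsetSum _ fun i _ =>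
      tendsto_finsetSum _ fun j _ => ?_).const_mul _)
    · exact ((h j ε hε).const_mul _).add ((h j M (hε.trans hεM)).const_mul _)
    · exact (h i δ hδ).mul (hp0 δ hδ j)
  · have hFI : ∀ (V : Ω → Fin d → ℝ≥0), Measurable V → Integrable (fun ω => F (V ω)) P :=
      fun V hV => Integrable.of_bound (hF.measurable.comp hV).aestronglyMeasurable C
        (Eventually.of_forall fun ω => hC _)
    have hsI : ∀ j, Integrable (fun ω => F (Pi.single j (W n ω j))) P := fun j =>
      hFI _ ((continuous_single (A := fun _ => ℝ≥0) j).measurable.comp (hWj n j))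
    have hAI : ∀ j, Integrable (fun ω => η * (Set.Ioi ε).indicator (1 : ℝ≥0 → ℝ) (W n ω j) +
        2 * C * (Set.Ioi M).indicator 1 (W n ω j)) P := fun j =>
      ((hindI _ _ _).const_mul _).add ((hindI _ _ _).const_mul _)
    have hBI : ∀ i, Integrable (fun ω => ∑ j ∈ Finset.univ.erase i,
        (Set.Ioi δ).indicator (1 : ℝ≥0 → ℝ) (W n ω i) * (Set.Ioi δ).indicator 1 (W n ω j)) P :=
      fun i => integrable_finsetSum _ fun j _ => hpairI _ _ _ _
    have hAs := integrable_finsetSum (Finset.univ (α := Fin d)) fun j _ => hAI j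
    have hBs := (integrable_finsetSum (Finset.univ (α := Fin d)) fun j _ => hBI j).const_mul
      ((d + 1) * C)
    have hdI : Integrable (fun ω => F (W n ω) - ∑ j, F (Pi.single j (W n ω j))) P :=
      (hFI _ (hW n)).sub (integrable_finsetSum _ fun j _ => hsI j)
    have key := (abs_integral_le_integral_abs (μ := P)).trans
      (integral_mono hdI.abs (hAs.add hBs) fun ω => hbound (W n ω))
    have e1 : (n : ℝ) * ∫ ω, F (W n ω) ∂P - ∑ j, n * ∫ ω, F (Pi.single j (W n ω j)) ∂P =
        n * ∫ ω, (F (W n ω) - ∑ j, F (Pi.single j (W n ω j))) ∂P := by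
      rw [integral_sub (hFI _ (hW n)) (integrable_finsetSum _ fun j _ => hsI j),
        integral_finsetSum _ fun j _ => hsI j, mul_sub, Finset.mul_sum]
    rw [e1, abs_mul, Nat.abs_cast]
    refine (mul_le_mul_of_nonneg_left key (Nat.cast_nonneg n)).trans_eq ?_
    simp only [Pi.add_apply]
    rw [integral_add hAs hBs, integral_finsetSum _ fun j _ => hAI j, integral_const_mul,
      integral_finsetSum _ fun j _ => hBI j, mul_add, Finset.mul_sum, mul_left_comm,
      Finset.mul_sum]
    congr 1
    · refine Finset.sum_congr rfl fun j _ => ?_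
      rw [integral_add ((hindI _ _ _).const_mul _) ((hindI _ _ _).const_mul _),
        integral_const_mul, integral_const_mul, hindE, hindE]
      simp only [hp]; ring
    · congr 1
      refine Finset.sum_congr rfl fun i _ => ?_
      rw [integral_finsetSum _ fun j _ => hpairI _ _ _ _, Finset.mul_sum]
      refine Finset.sum_congr rfl fun j hj => ?_
      rw [hpairE _ _ _ _ (Finset.mem_erase.1 hj).1]
      simp only [hp]; ring
  · simpa using hκ.le
  · simp only [mul_zero, Finset.sum_const_zero, add_zero, Finset.sum_const, Finset.card_univ,
      Fintype.card_fin, nsmul_eq_mul, mul_add]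
    linarith

/-! ### Boxes around the origin -/

section Neighbourhoods

lemma exists_pos_forall_le_of_eventually {d : ℕ} {p : (Fin d → ℝ≥0) → Prop}
    (h : ∀ᶠ z in 𝓝 0, p z) : ∃ ε : ℝ≥0, 0 < ε ∧ ∀ z, (∀ i, z i ≤ ε) → p z := by
  obtain ⟨ε, hε, h⟩ := Metric.nhds_basis_closedBall.eventually_iff.1 h
  refine ⟨⟨ε, hε.le⟩, hε, fun z hz => h ?_⟩
  rw [Metric.mem_closedBall, dist_pi_le_iff hε.le]
  intro i
  rw [Pi.zero_apply, NNReal.dist_eq, NNReal.coe_zero, sub_zero, NNReal.abs_eq]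
  exact hz i

lemma exists_pos_forall_le_of_eventually_nnreal {p : ℝ≥0 → Prop}
    (h : ∀ᶠ x in 𝓝 0, p x) : ∃ ε : ℝ≥0, 0 < ε ∧ ∀ x, x ≤ ε → p x := by
  obtain ⟨ε, hε, h⟩ := Metric.nhds_basis_closedBall.eventually_iff.1 h
  refine ⟨⟨ε, hε.le⟩, hε, fun x hx => h ?_⟩
  rw [Metric.mem_closedBall, NNReal.dist_eq, NNReal.coe_zero, sub_zero, NNReal.abs_eq]
  exact hx

end Neighbourhoods

/-! ### Integrability and the passage to `(0, ∞]` -/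

section Tail

/-- The mass is infinite only near `0`, which is outside the support of `g`. -/
lemma integrable_tailMeasure_of_eventually_zero {α : ℝ} (hα : 0 < α) {g : ℝ≥0 → ℝ}
    (hg : Measurable g) {C : ℝ} (hC : ∀ x, |g x| ≤ C) (h0 : ∀ᶠ x in 𝓝 0, g x = 0) :
    Integrable g (tailMeasure α) := by
  obtain ⟨ε, hε, h⟩ := exists_pos_forall_le_of_eventually_nnreal h0
  have : g = (Set.Ioi ε).indicator g := by
    ext x
    by_cases hx : ε < x
    · simp [hx]
    · simp [hx, h x (not_lt.1 hx)]
  rw [this, integrable_indicator_iff measurableSet_Ioi]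
  exact Measure.integrableOn_of_bounded (tailMeasure_Ioi_ne_top hα hε) hg.aestronglyMeasurable
    (Eventually.of_forall hC)

lemma ae_pos_tailMeasure (α : ℝ) : ∀ᵐ x ∂(tailMeasure α), 0 < x := by
  rw [ae_iff, tailMeasure, Measure.map_apply (by fun_prop) (by measurability)]
  apply withDensity_absolutelyContinuous
  rw [Measure.restrict_apply (by measurability)]
  convert measure_empty (μ := (volume : Measure ℝ))
  ext x
  simp

/-- The inclusion of `(0, ∞)` in `(0, ∞]`, with an arbitrary value at `0`. -/
noncomputable def toPosExt (x : ℝ≥0) : PosExt :=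
  ⟨if 0 < x then (x : ℝ≥0∞) else 1, by split_ifs <;> simp_all⟩

lemma measurable_toPosExt : Measurable toPosExt :=
  (Measurable.ite measurableSet_Ioi (by fun_prop) (by fun_prop)).subtype_mk

lemma measurableEmbedding_posExt : MeasurableEmbedding (Subtype.val : PosExt → ℝ≥0∞) :=
  MeasurableEmbedding.subtype_coe measurableSet_Ioi

/-- A push-forward is easier to integrate against, and to multiply by a Dirac mass, than a `comap`.
The arbitrary value of `toPosExt` at `0` is invisible because `0` is a null set. -/
lemma powerMeasure_eq_map (α : ℝ) : powerMeasure α = (tailMeasure α).map toPosExt := by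
  rw [powerMeasure_eq, ← measurableEmbedding_posExt.comap_map ((tailMeasure α).map toPosExt),
    Measure.map_map measurable_subtype_coe measurable_toPosExt]
  congr 1
  refine Measure.map_congr ?_
  filter_upwards [ae_pos_tailMeasure α] with x hx
  simp [toPosExt, hx]

instance (α : ℝ) : SFinite (powerMeasure α) := by
  rw [powerMeasure_eq_map]; infer_instance

end Tail

/-! ### Norms on the orthant and their spheres -/

section Norm

variable {d : ℕ} {N : Seminorm ℝ (Fin d → ℝ)}

lemma continuous_seminorm (N : Seminorm ℝ (Fin d → ℝ)) : Continuous N :=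
  continuousOn_univ.1 (N.convexOn.continuousOn isOpen_univ)

lemma continuous_posNorm (N : Seminorm ℝ (Fin d → ℝ)) : Continuous (posNorm N) :=
  Continuous.subtype_mk ((continuous_seminorm N).comp (by fun_prop)) _

lemma coe_posNorm (x : Fin d → ℝ≥0) : (posNorm N x : ℝ) = N fun i => (x i : ℝ) := rfl

lemma posNorm_zero : posNorm N 0 = 0 := by
  rw [← NNReal.coe_inj, coe_posNorm]
  exact map_zero N

lemma posNorm_smul (c : ℝ≥0) (x : Fin d → ℝ≥0) : posNorm N (c • x) = c * posNorm N x := by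
  rw [← NNReal.coe_inj, NNReal.coe_mul, coe_posNorm, coe_posNorm]
  have := map_smul_eq_mul N (c : ℝ) (fun i => (x i : ℝ))
  rw [Real.norm_of_nonneg c.coe_nonneg] at this
  rw [← this]
  congr 1

lemma posNorm_eq_zero (hN : IsNorm N) {x : Fin d → ℝ≥0} : posNorm N x = 0 ↔ x = 0 := by
  refine ⟨fun h => ?_, fun h => h ▸ posNorm_zero⟩
  rw [← NNReal.coe_inj, coe_posNorm] at h
  have := hN _ h
  ext i
  simpa using congrFun this i

lemma posNorm_inv_smul {x : Fin d → ℝ≥0} (hx : posNorm N x ≠ 0) :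
    posNorm N ((posNorm N x)⁻¹ • x) = 1 := by
  rw [posNorm_smul, inv_mul_cancel₀ hx]

lemma inv_smul_smul_direction {c : ℝ≥0} (hc : c ≠ 0) (x : Fin d → ℝ≥0) :
    (posNorm N (c • x))⁻¹ • (c • x) = (posNorm N x)⁻¹ • x := by
  rw [posNorm_smul, smul_smul, mul_inv, mul_right_comm, inv_mul_cancel₀ hc, one_mul]

lemma isClosed_posSphere (N : Seminorm ℝ (Fin d → ℝ)) :
    IsClosed {θ : Fin d → ℝ≥0 | posNorm N θ = 1} :=
  isClosed_eq (continuous_posNorm N) continuous_const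

lemma measurableEmbedding_posSphere (N : Seminorm ℝ (Fin d → ℝ)) :
    MeasurableEmbedding (Subtype.val : PosSphere N → Fin d → ℝ≥0) :=
  MeasurableEmbedding.subtype_coe (isClosed_posSphere N).measurableSet

/-- The constant is the minimum of `N` over the compact unit sphere of the supremum norm, positive
by definiteness. -/
lemma exists_pos_mul_norm_le (hN : IsNorm N) : ∃ m > 0, ∀ x, m * ‖x‖ ≤ N x := by
  -- The sphere is empty exactly when `d = 0`.
  rcases (Metric.sphere (0 : Fin d → ℝ) 1).eq_empty_or_nonempty with h | h
  · refine ⟨1, one_pos, fun x => ?_⟩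
    by_cases hx : x = 0
    · simp [hx]
    · have : ‖x‖⁻¹ • x ∈ Metric.sphere (0 : Fin d → ℝ) 1 := by
        simp [norm_smul, norm_ne_zero_iff.2 hx]
      simp [h] at this
  obtain ⟨y, hy, hmin⟩ := (isCompact_sphere (0 : Fin d → ℝ) 1).exists_isMinOn h
    (continuous_seminorm N).continuousOn
  have hy0 : y ≠ 0 := by rintro rfl; simp at hy
  refine ⟨N y, lt_of_le_of_ne (apply_nonneg N y) fun h0 => hy0 (hN y h0.symm), fun x => ?_⟩
  by_cases hx : x = 0
  · simp [hx]
  · have hx' : ‖x‖ ≠ 0 := norm_ne_zero_iff.2 hx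
    have h1 : N y ≤ N (‖x‖⁻¹ • x) := hmin (by simp [norm_smul, hx'])
    rw [map_smul_eq_mul, norm_inv, norm_norm] at h1
    have := mul_le_mul_of_nonneg_right h1 (norm_nonneg x)
    rwa [mul_right_comm, inv_mul_cancel₀ hx', one_mul] at this

lemma compactSpace_posSphere (hN : IsNorm N) : CompactSpace (PosSphere N) := by
  refine isCompact_iff_compactSpace.1 (Metric.isCompact_of_isClosed_isBounded
    (isClosed_posSphere N) ?_)
  obtain ⟨m, hm, h⟩ := exists_pos_mul_norm_le hN
  refine (Metric.isBounded_closedBall (x := (0 : Fin d → ℝ≥0)) (r := m⁻¹)).subset fun θ hθ => ?_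
  rw [Metric.mem_closedBall, dist_pi_le_iff (by positivity)]
  intro i
  have h1 : N (fun i => (θ i : ℝ)) = 1 := by
    rw [← coe_posNorm, show posNorm N θ = 1 from hθ, NNReal.coe_one]
  have h2 := h fun i => (θ i : ℝ)
  have h3 := norm_le_pi_norm (fun i => (θ i : ℝ)) i
  rw [h1] at h2
  rw [Pi.zero_apply, NNReal.dist_eq, NNReal.coe_zero, sub_zero, ← Real.norm_eq_abs]
  refine h3.trans ?_
  rwa [← one_div, le_div_iff₀' hm]

end Norm

/-! ### Extension by zero along an embedding -/

section Extension

/-- The scaled laws are restrictions of push-forwards to a subtype; extending the integrand by zero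
gives an integral over the ambient space, hence an expectation. -/
lemma integral_comap {E E' : Type*} [MeasurableSpace E] [MeasurableSpace E'] {e : E → E'}
    (he : MeasurableEmbedding e) (μ : Measure E') (f : E → ℝ) :
    ∫ x, f x ∂(μ.comap e) = ∫ y, Function.extend e f 0 y ∂μ := by
  have h1 : ∫ x, f x ∂(μ.comap e) = ∫ x, Function.extend e f 0 (e x) ∂(μ.comap e) := by
    simp [he.injective.extend_apply]
  rw [h1, ← he.integral_map, he.map_comap]
  refine setIntegral_eq_integral_of_forall_compl_eq_zero fun y hy => ?_
  rw [Function.extend_apply' _ _ _ (by simpa using hy)]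
  rfl

lemma integrable_comap {E E' : Type*} [MeasurableSpace E] [MeasurableSpace E'] {e : E → E'}
    (he : MeasurableEmbedding e) {μ : Measure E'} {f : E → ℝ}
    (hf : Integrable (Function.extend e f 0) μ) : Integrable f (μ.comap e) := by
  have h : Integrable (Function.extend e f 0) ((μ.comap e).map e) := by
    rw [he.map_comap]; exact hf.restrict
  rw [he.integrable_map_iff] at h
  convert! h using 1
  ext x
  simp [he.injective.extend_apply]

lemma abs_extend_le {E E' : Type*} {e : E → E'} (he : Function.Injective e) {f : E → ℝ} {C : ℝ}
    (hC0 : 0 ≤ C) (hC : ∀ x, |f x| ≤ C) (y : E') : |Function.extend e f 0 y| ≤ C := by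
  by_cases hy : ∃ x, e x = y
  · obtain ⟨x, rfl⟩ := hy
    rw [he.extend_apply]; exact hC x
  · rw [Function.extend_apply' _ _ _ hy]; simpa using hC0

/-- Continuity of the zero extension of a function, read along a map that is continuous away from
one point, if it vanishes near that point. -/
lemma continuous_extend_comp {T E E' : Type*} [TopologicalSpace T] [T1Space T]
    [TopologicalSpace E] [TopologicalSpace E'] {e : E → E'}
    (he : IsEmbedding e) {f : E → ℝ} (hf : Continuous f) {ψ : T → E'} {t₀ : T}
    (hψ : ContinuousOn ψ {t₀}ᶜ) (hrange : ∀ t ≠ t₀, ψ t ∈ Set.range e)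
    (h0 : ∀ᶠ t in 𝓝 t₀, Function.extend e f 0 (ψ t) = 0) :
    Continuous fun t => Function.extend e f 0 (ψ t) := by
  rw [continuous_iff_continuousAt]
  intro t
  by_cases ht : t = t₀
  · subst ht
    exact (continuousAt_const (y := (0 : ℝ))).congr (h0.mono fun _ h => h.symm)
  · refine ContinuousOn.continuousAt (s := {t₀}ᶜ) ?_ (isOpen_compl_singleton.mem_nhds ht)
    rw [continuousOn_iff_continuous_domRestrict]
    -- Away from `t₀` the map `ψ` factors through `e`, and the factor is continuous because `e` is
    -- an embedding.
    choose φ hφ using fun t : ({t₀}ᶜ : Set T) => hrange t t.2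
    have hφc : Continuous φ := by
      rw [he.continuous_iff]
      convert! continuousOn_iff_continuous_domRestrict.1 hψ using 1
      ext t
      simp [hφ]
    convert! hf.comp hφc using 1
    ext t
    simp [← hφ, he.injective.extend_apply]

lemma extend_eq_zero_of_notMem_image {E E' : Type*} [TopologicalSpace E] {e : E → E'}
    (he : Function.Injective e) {f : E → ℝ} {y : E'} (hy : y ∉ e '' tsupport f) :
    Function.extend e f 0 y = 0 := by
  by_cases h : ∃ x, e x = y
  · obtain ⟨x, rfl⟩ := h
    rw [he.extend_apply]
    by_contra h1
    exact hy ⟨x, subset_tsupport f h1, rfl⟩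
  · rw [Function.extend_apply' _ _ _ h]; rfl

end Extension

/-! ### The limit for `A Z` -/

variable {d : ℕ}

lemma mulVec_single_eq_smul (A : Matrix (Fin d) (Fin d) ℝ≥0) (j : Fin d) (x : ℝ≥0) :
    A *ᵥ Pi.single j x = x • fun i => A i j := by
  ext i
  simp [mul_comm]

/-- Scaled expectations of functions of `A Z` that vanish near the origin. -/
lemma tendsto_integral_mulVec {Ω : Type*} [MeasurableSpace Ω] {P : Measure Ω}
    [IsProbabilityMeasure P] {α : ℝ} (hα : 0 < α) {Z : Ω → Fin d → ℝ≥0} (hZ : Measurable Z)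
    (hind : iIndepFun (fun i ω => Z ω i) P) (hstd : IsStandardised P Z α)
    (A : Matrix (Fin d) (Fin d) ℝ≥0) {G : (Fin d → ℝ≥0) → ℝ} (hG : Continuous G) {C : ℝ}
    (hC : ∀ y, |G y| ≤ C) (h0 : ∀ᶠ y in 𝓝 0, G y = 0) :
    Tendsto (fun n : ℕ => n * ∫ ω, G (((n : ℝ≥0) ^ (1 / α))⁻¹ • (A *ᵥ Z ω)) ∂P) atTop
      (𝓝 (∑ j, ∫ x, G (x • fun i => A i j) ∂(tailMeasure α))) := by
  have hA : Continuous fun z : Fin d → ℝ≥0 => A *ᵥ z := by fun_prop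
  have hA0 : Tendsto (fun z : Fin d → ℝ≥0 => A *ᵥ z) (𝓝 0) (𝓝 0) := by
    simpa using hA.tendsto 0
  obtain ⟨ε, hε, hGε⟩ := exists_pos_forall_le_of_eventually (hA0.eventually h0)
  -- Scaling commutes with `A`, so one big jump applies to the scaled `Z` and to `G ∘ A`, which
  -- vanishes near the origin because `A` is continuous and fixes it.
  have key := tendsto_integral_of_iIndepFun (P := P)
    (W := fun n ω => ((n : ℝ≥0) ^ (1 / α))⁻¹ • Z ω) (fun n => by fun_prop)
    (fun n => hind.comp (fun _ x => ((n : ℝ≥0) ^ (1 / α))⁻¹ * x) (fun _ => by fun_prop))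
    (ν := tailMeasure α) (fun z hz => tailMeasure_Ioi_ne_top hα hz)
    (fun i z hz => by
      rw [tailMeasure_real_Ioi hα hz]
      refine (hstd i z hz).congr fun n => ?_
      congr 3
      ext ω
      rw [← NNReal.coe_lt_coe]
      simp [Real.rpow_neg])
    (tendsto_tailMeasure_real_Ioi hα) (F := fun z => G (A *ᵥ z)) (hG.comp hA) (fun z => hC _)
    hε hGε
  simpa only [Matrix.mulVec_smul, mulVec_single_eq_smul] using key

/-! ### Cartesian and polar test functions on the orthant -/

section Test

/-- A test function on the punctured orthant, extended by zero to `ℝ_+^d`. -/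
noncomputable def cartesianTest (f : Punctured d → ℝ) (y : Fin d → ℝ≥0) : ℝ :=
  Function.extend Subtype.val f 0 fun i => (y i : ℝ≥0∞)

/-- A test function in polar coordinates, extended by zero to `ℝ_+^d`. -/
noncomputable def polarTest {N : Seminorm ℝ (Fin d → ℝ)} (f : PosExt × PosSphere N → ℝ)
    (y : Fin d → ℝ≥0) : ℝ :=
  Function.extend (Prod.map Subtype.val Subtype.val) f 0
    ((posNorm N y : ℝ≥0∞), (posNorm N y)⁻¹ • y)

lemma measurableEmbedding_punctured :
    MeasurableEmbedding (Subtype.val : Punctured d → Fin d → ℝ≥0∞) :=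
  MeasurableEmbedding.subtype_coe (measurableSet_singleton (0 : Fin d → ℝ≥0∞)).compl

lemma measurableEmbedding_polar (N : Seminorm ℝ (Fin d → ℝ)) : MeasurableEmbedding
    (Prod.map Subtype.val Subtype.val : PosExt × PosSphere N → ℝ≥0∞ × (Fin d → ℝ≥0)) :=
  measurableEmbedding_posExt.prodMap (measurableEmbedding_posSphere N)

lemma continuous_coe_pi : Continuous fun (y : Fin d → ℝ≥0) i => (y i : ℝ≥0∞) := by fun_prop

/-- Points near the origin lie outside a compact subset of the punctured orthant. -/
lemma eventually_notMem_of_isCompact_punctured {K : Set (Punctured d)} (hK : IsCompact K) :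
    ∀ᶠ y : Fin d → ℝ≥0 in 𝓝 0, (fun i => (y i : ℝ≥0∞)) ∉ Subtype.val '' K := by
  have h1 : IsClosed (Subtype.val '' K) := (hK.image continuous_subtype_val).isClosed
  refine (continuous_coe_pi.tendsto 0).eventually (h1.isOpen_compl.mem_nhds ?_)
  rintro ⟨x, -, hx⟩
  refine x.2 (hx.trans ?_)
  ext i; simp

lemma eventually_cartesianTest_eq_zero {f : Punctured d → ℝ} (hf : HasCompactSupport f) :
    ∀ᶠ y in 𝓝 0, cartesianTest f y = 0 :=
  (eventually_notMem_of_isCompact_punctured hf).mono fun _ hy =>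
    extend_eq_zero_of_notMem_image Subtype.val_injective hy

lemma continuous_cartesianTest {f : Punctured d → ℝ} (hf : Continuous f)
    (hfc : HasCompactSupport f) : Continuous (cartesianTest f) := by
  refine continuous_extend_comp IsEmbedding.subtypeVal hf continuous_coe_pi.continuousOn
    (t₀ := 0) (fun y hy => ⟨⟨fun i => (y i : ℝ≥0∞), fun h => hy ?_⟩, rfl⟩)
    (eventually_cartesianTest_eq_zero hfc)
  ext i
  simpa using congrFun h i

/-- The radii occurring in the support form a compact subset of `(0, ∞]`, hence a closed subset of
`[0, ∞]` that misses `0`. -/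
lemma eventually_polarTest_eq_zero {N : Seminorm ℝ (Fin d → ℝ)} {f : PosExt × PosSphere N → ℝ}
    (hf : HasCompactSupport f) : ∀ᶠ y in 𝓝 0, polarTest f y = 0 := by
  have h1 : IsClosed ((fun p : PosExt × PosSphere N => (p.1 : ℝ≥0∞)) '' tsupport f) :=
    (IsCompact.image hf (by fun_prop)).isClosed
  have h2 : Continuous fun y => (posNorm N y : ℝ≥0∞) :=
    ENNReal.continuous_coe.comp (continuous_posNorm N)
  have h3 := (h2.tendsto 0).eventually (h1.isOpen_compl.mem_nhds (by
    rintro ⟨p, -, hp⟩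
    have := p.1.2
    rw [posNorm_zero] at hp
    simp [hp] at this))
  filter_upwards [h3] with y hy
  refine extend_eq_zero_of_notMem_image
    (Subtype.val_injective.prodMap Subtype.val_injective) ?_
  rintro ⟨p, hp, hpy⟩
  exact hy ⟨p, hp, congrArg Prod.fst hpy⟩

/-- The angle can jump only at the origin, and there the test function vanishes in a whole
neighbourhood. -/
lemma continuous_polarTest {N : Seminorm ℝ (Fin d → ℝ)} (hN : IsNorm N)
    {f : PosExt × PosSphere N → ℝ} (hf : Continuous f) (hfc : HasCompactSupport f) :
    Continuous (polarTest f) := by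
  have hne : ∀ y : Fin d → ℝ≥0, y ≠ 0 → posNorm N y ≠ 0 := fun y hy h =>
    hy ((posNorm_eq_zero hN).1 h)
  refine continuous_extend_comp (IsEmbedding.subtypeVal.prodMap IsEmbedding.subtypeVal) hf
    (t₀ := 0) ?_ (fun y hy => ?_) (eventually_polarTest_eq_zero hfc)
  · refine ContinuousOn.prodMk
      (ENNReal.continuous_coe.comp (continuous_posNorm N)).continuousOn ?_
    exact ((continuous_posNorm N).continuousOn.inv₀ fun y hy => hne y hy).smul continuousOn_id
  · exact ⟨(⟨posNorm N y, by simpa [pos_iff_ne_zero] using hne y hy⟩,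
      ⟨(posNorm N y)⁻¹ • y, posNorm_inv_smul (hne y hy)⟩), rfl⟩

lemma abs_cartesianTest_le {f : Punctured d → ℝ} {C : ℝ} (hC0 : 0 ≤ C) (hC : ∀ x, |f x| ≤ C)
    (y : Fin d → ℝ≥0) : |cartesianTest f y| ≤ C :=
  abs_extend_le Subtype.val_injective hC0 hC _

lemma abs_polarTest_le {N : Seminorm ℝ (Fin d → ℝ)} {f : PosExt × PosSphere N → ℝ} {C : ℝ}
    (hC0 : 0 ≤ C) (hC : ∀ x, |f x| ≤ C) (y : Fin d → ℝ≥0) : |polarTest f y| ≤ C :=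
  abs_extend_le (Subtype.val_injective.prodMap Subtype.val_injective) hC0 hC _

lemma exists_abs_le_of_hasCompactSupport {E : Type*} [TopologicalSpace E] {f : E → ℝ}
    (hf : Continuous f) (hfc : HasCompactSupport f) : ∃ C, 0 ≤ C ∧ ∀ x, |f x| ≤ C := by
  obtain ⟨C, hC⟩ := hfc.exists_bound_of_continuous hf
  exact ⟨max C 0, le_max_right _ _, fun x => (hC x).trans (le_max_left _ _)⟩

end Test

/-! ### Integrals against the scaled laws as expectations -/

section Laws

variable {Ω : Type*} [MeasurableSpace Ω] {P : Measure Ω} {X : Ω → Fin d → ℝ≥0}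

lemma integral_scaledLaw (hX : Measurable X) (b : ℕ → ℝ≥0) (n : ℕ) {f : Punctured d → ℝ}
    (hf : Continuous f) :
    ∫ x, f x ∂(scaledLaw P X b n) = n * ∫ ω, cartesianTest f ((b n)⁻¹ • X ω) ∂P := by
  rw [scaledLaw, integral_smul_measure, integral_comap measurableEmbedding_punctured,
    integral_map]
  · simp only [ENNReal.toReal_natCast, smul_eq_mul, cartesianTest]
    simp [div_eq_inv_mul]
  · have : ∀ i, Measurable fun ω => X ω i := fun i => measurable_pi_iff.1 hX i
    exact (measurable_pi_iff.2 fun i => ((this i).div_const _).coe_nnreal_ennreal).aemeasurable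
  · exact (measurableEmbedding_punctured.measurable_extend hf.measurable
      measurable_zero).aestronglyMeasurable

/-- Dividing by a non-zero `b n` rescales the radius and preserves the angle. -/
lemma integral_scaledPolarLaw (N : Seminorm ℝ (Fin d → ℝ)) (hX : Measurable X) {b : ℕ → ℝ≥0}
    {n : ℕ} (hb : b n ≠ 0) {f : PosExt × PosSphere N → ℝ} (hf : Continuous f) :
    ∫ x, f x ∂(scaledPolarLaw P N X b n) = n * ∫ ω, polarTest f ((b n)⁻¹ • X ω) ∂P := by
  have hNX : Measurable fun ω => posNorm N (X ω) := (continuous_posNorm N).measurable.comp hX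
  rw [scaledPolarLaw, integral_smul_measure, integral_comap (measurableEmbedding_polar N),
    integral_map]
  · simp only [ENNReal.toReal_natCast, smul_eq_mul, polarTest,
      inv_smul_smul_direction (inv_ne_zero hb)]
    simp only [posNorm_smul, div_eq_inv_mul]
  · exact ((hNX.div_const _).coe_nnreal_ennreal.prodMk (hNX.inv.smul hX)).aemeasurable
  · exact ((measurableEmbedding_polar N).measurable_extend hf.measurable
      measurable_zero).aestronglyMeasurable

end Laws

/-! ### The exponent measure -/

section Exponent

/-- The exponent measure of `A Z`: the sum of the images of the power measure on the rays through
the columns of `A`. -/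
noncomputable def columnExponentMeasure (A : Matrix (Fin d) (Fin d) ℝ≥0) (α : ℝ) :
    Measure (Punctured d) :=
  -- A zero column puts its whole mass at the origin, which the `comap` discards.
  ∑ j, ((tailMeasure α).map fun x i => ((x * A i j : ℝ≥0) : ℝ≥0∞)).comap Subtype.val

lemma measurable_ray (v : Fin d → ℝ≥0) :
    Measurable fun (x : ℝ≥0) i => ((x * v i : ℝ≥0) : ℝ≥0∞) := by fun_prop

lemma tendsto_smul_zero_nnreal (v : Fin d → ℝ≥0) :
    Tendsto (fun x : ℝ≥0 => x • v) (𝓝 0) (𝓝 0) := by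
  have : Continuous fun x : ℝ≥0 => x • v := by fun_prop
  simpa using this.tendsto 0

/-- A compact set stays away from the origin, so each ray meets it only at parameters beyond some `ε
> 0`. -/
lemma isFiniteMeasureOnCompacts_columnExponentMeasure (A : Matrix (Fin d) (Fin d) ℝ≥0) {α : ℝ}
    (hα : 0 < α) : IsFiniteMeasureOnCompacts (columnExponentMeasure A α) := by
  refine ⟨fun K hK => ?_⟩
  rw [columnExponentMeasure, Measure.finsetSum_apply]
  refine ENNReal.sum_lt_top.2 fun j _ => ?_
  have hKm : MeasurableSet (Subtype.val '' K) :=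
    (hK.image continuous_subtype_val).isClosed.measurableSet
  rw [measurableEmbedding_punctured.comap_apply, Measure.map_apply (measurable_ray _) hKm]
  obtain ⟨ε, hε, h⟩ := exists_pos_forall_le_of_eventually_nnreal
    ((tendsto_smul_zero_nnreal fun i => A i j).eventually
      (eventually_notMem_of_isCompact_punctured hK))
  refine (measure_mono fun x hx => ?_).trans_lt (tailMeasure_Ioi_ne_top hα hε).lt_top
  by_contra h1
  exact h x (not_lt.1 h1) hx

lemma integral_columnExponentMeasure (A : Matrix (Fin d) (Fin d) ℝ≥0) {α : ℝ} (hα : 0 < α)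
    {f : Punctured d → ℝ} (hf : Continuous f) (hfc : HasCompactSupport f) :
    ∫ x, f x ∂(columnExponentMeasure A α) =
      ∑ j, ∫ x, cartesianTest f (x • fun i => A i j) ∂(tailMeasure α) := by
  obtain ⟨C, hC0, hC⟩ := exists_abs_le_of_hasCompactSupport hf hfc
  have hm := measurableEmbedding_punctured.measurable_extend hf.measurable
    (measurable_zero (α := ℝ) (β := Fin d → ℝ≥0∞))
  rw [columnExponentMeasure, integral_finsetSum_measure]
  · refine Finset.sum_congr rfl fun j _ => ?_
    rw [integral_comap measurableEmbedding_punctured, integral_map (measurable_ray _).aemeasurable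
      hm.aestronglyMeasurable]
    rfl
  · intro j _
    apply integrable_comap measurableEmbedding_punctured
    rw [integrable_map_measure hm.aestronglyMeasurable (measurable_ray _).aemeasurable]
    exact integrable_tailMeasure_of_eventually_zero hα (hm.comp (measurable_ray _))
      (fun x => abs_extend_le Subtype.val_injective hC0 hC _)
      ((tendsto_smul_zero_nnreal fun i => A i j).eventually
        (eventually_cartesianTest_eq_zero hfc))

lemma measurableEmbedding_coe_pi :
    MeasurableEmbedding fun (y : Fin d → ℝ≥0) i => (y i : ℝ≥0∞) :=
  continuous_coe_pi.measurableEmbedding fun y z h => by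
    ext i
    simpa using congrFun h i

/-- Moves the cone into `ℝ_+^d`, where its measurability is visible; `1 ≤ ‖y‖` keeps the origin out.
-/
lemma image_outerCone (N : Seminorm ℝ (Fin d → ℝ)) (C : Set (PosSphere N)) :
    Subtype.val '' outerCone N C = (fun (y : Fin d → ℝ≥0) i => (y i : ℝ≥0∞)) ''
      {y | 1 ≤ posNorm N y ∧ (posNorm N y)⁻¹ • y ∈ Subtype.val '' C} := by
  ext x
  constructor
  · rintro ⟨x, ⟨y, hxy, hy, θ, hθ, hθy⟩, rfl⟩
    exact ⟨y, ⟨hy, θ, hθ, hθy⟩, (funext hxy).symm⟩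
  · rintro ⟨y, ⟨hy, θ, hθ, hθy⟩, rfl⟩
    refine ⟨⟨_, fun h => ?_⟩, ⟨y, fun i => rfl, hy, θ, hθ, hθy⟩, rfl⟩
    have : y = 0 := funext fun i => ENNReal.coe_eq_zero.1 (congrFun h i)
    rw [this, posNorm_zero] at hy
    simp at hy

/-- If the direction of a column `v` lies in `C`, the ray `x • v` is in the cone exactly for `x ≥
‖v‖⁻¹`, a set of mass `‖v‖ ^ α`; otherwise the ray misses the cone. -/
lemma columnAngularMeasure_eq_outerCone (N : Seminorm ℝ (Fin d → ℝ))
    (A : Matrix (Fin d) (Fin d) ℝ≥0) {α : ℝ} (hα : 0 < α) {C : Set (PosSphere N)}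
    (hC : MeasurableSet C) :
    columnAngularMeasure N A α C = columnExponentMeasure A α (outerCone N C) := by
  have hCm : MeasurableSet (Subtype.val '' C) :=
    (measurableEmbedding_posSphere N).measurableSet_image.2 hC
  have hcont := continuous_posNorm N
  have hSm : MeasurableSet
      {y : Fin d → ℝ≥0 | 1 ≤ posNorm N y ∧ (posNorm N y)⁻¹ • y ∈ Subtype.val '' C} := by
    refine (measurableSet_le measurable_const hcont.measurable).inter ?_
    exact (hcont.measurable.inv.smul measurable_id) hCm
  rw [columnAngularMeasure, columnExponentMeasure, (measurableEmbedding_posSphere N).comap_apply,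
    Measure.finsetSum_apply, Measure.finsetSum_apply]
  refine Finset.sum_congr rfl fun j _ => ?_
  set v : Fin d → ℝ≥0 := fun i => A i j with hv
  have hpre : (fun (x : ℝ≥0) i => ((x * A i j : ℝ≥0) : ℝ≥0∞)) ⁻¹' (Subtype.val '' outerCone N C) =
      {x | 1 ≤ x * posNorm N v ∧ (posNorm N v)⁻¹ • v ∈ Subtype.val '' C} := by
    ext x
    have hx : (fun i => ((x * A i j : ℝ≥0) : ℝ≥0∞)) =
      (fun (y : Fin d → ℝ≥0) i => (y i : ℝ≥0∞)) (x • v) := rfl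
    rw [Set.mem_preimage, image_outerCone, hx,
      measurableEmbedding_coe_pi.injective.mem_set_image, Set.mem_ofPred_eq, Set.mem_ofPred_eq,
      posNorm_smul, ← posNorm_smul]
    refine and_congr_right fun h => ?_
    rw [inv_smul_smul_direction]
    rintro rfl
    simp [posNorm_zero] at h
  rw [measurableEmbedding_punctured.comap_apply, Measure.map_apply (measurable_ray _)
    (by rw [image_outerCone]; exact measurableEmbedding_coe_pi.measurableSet_image.2 hSm), hpre,
    Measure.smul_apply, Measure.dirac_apply' _ hCm, smul_eq_mul]
  by_cases h0 : posNorm N v = 0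
  · simp [h0, NNReal.zero_rpow hα.ne']
  by_cases h1 : (posNorm N v)⁻¹ • v ∈ Subtype.val '' C
  · have : {x | 1 ≤ x * posNorm N v ∧ (posNorm N v)⁻¹ • v ∈ Subtype.val '' C} =
        Set.Ici (posNorm N v)⁻¹ := by
      ext x
      simp only [h1, and_true, Set.mem_ofPred_eq, Set.mem_Ici]
      rw [inv_le_iff_one_le_mul₀ (pos_iff_ne_zero.2 h0)]
    rw [this, tailMeasure_Ici hα (by simpa [pos_iff_ne_zero] using h0), Set.indicator_of_mem h1,
      Pi.one_apply, mul_one, NNReal.coe_inv, Real.inv_rpow (NNReal.coe_nonneg _),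
      Real.rpow_neg (NNReal.coe_nonneg _), inv_inv, ← NNReal.coe_rpow, ENNReal.ofReal_coe_nnreal]
  · simp [h1]

end Exponent

/-! ### The angular measure -/

section Angular

/-- The contribution of the `j`-th column to the angular measure. -/
noncomputable def columnDirac (N : Seminorm ℝ (Fin d → ℝ)) (A : Matrix (Fin d) (Fin d) ℝ≥0)
    (α : ℝ) (j : Fin d) : Measure (PosSphere N) :=
  if h : posNorm N (fun i => A i j) = 0 then 0 else
    (posNorm N (fun i => A i j) ^ α : ℝ≥0) • Measure.dirac
      ⟨(posNorm N (fun i => A i j))⁻¹ • (fun i => A i j), posNorm_inv_smul h⟩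

instance (N : Seminorm ℝ (Fin d → ℝ)) (A : Matrix (Fin d) (Fin d) ℝ≥0) (α : ℝ) (j : Fin d) :
    IsFiniteMeasure (columnDirac N A α j) := by
  unfold columnDirac
  split_ifs <;> infer_instance

/-- With Dirac masses on the sphere itself, the product with the power measure can be computed
column by column. -/
lemma columnAngularMeasure_eq_sum (N : Seminorm ℝ (Fin d → ℝ))
    (A : Matrix (Fin d) (Fin d) ℝ≥0) {α : ℝ} (hα : 0 < α) :
    columnAngularMeasure N A α = ∑ j : Fin d, columnDirac N A α j := by
  ext C hC
  have hCm : MeasurableSet (Subtype.val '' C) :=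
    (measurableEmbedding_posSphere N).measurableSet_image.2 hC
  rw [columnAngularMeasure, (measurableEmbedding_posSphere N).comap_apply,
    Measure.finsetSum_apply, Measure.finsetSum_apply]
  refine Finset.sum_congr rfl fun j _ => ?_
  unfold columnDirac
  split_ifs with h
  · simp [h, NNReal.zero_rpow hα.ne']
  · rw [Measure.smul_apply, Measure.smul_apply, Measure.dirac_apply' _ hCm,
      Measure.dirac_apply' _ hC, ENNReal.smul_def, smul_eq_mul]
    congr 1
    by_cases hv : (⟨_, posNorm_inv_smul h⟩ : PosSphere N) ∈ C
    · rw [Set.indicator_of_mem hv, Set.indicator_of_mem (s := Subtype.val '' C) ⟨_, hv, rfl⟩]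
      rfl
    · rw [Set.indicator_of_notMem hv, Set.indicator_of_notMem]
      rintro ⟨θ, hθ, hθv⟩
      refine hv ?_
      convert! hθ
      exact hθv.symm

lemma isFiniteMeasure_columnAngularMeasure (N : Seminorm ℝ (Fin d → ℝ))
    (A : Matrix (Fin d) (Fin d) ℝ≥0) (α : ℝ) : IsFiniteMeasure (columnAngularMeasure N A α) := by
  have : IsFiniteMeasure (∑ j : Fin d, ((posNorm N (fun i => A i j) ^ α : ℝ≥0) : ℝ≥0∞) •
      Measure.dirac ((posNorm N (fun i => A i j))⁻¹ • (fun i => A i j))) := by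
    refine ⟨?_⟩
    rw [Measure.finsetSum_apply]
    exact ENNReal.sum_lt_top.2 fun j _ => by simp
  rw [columnAngularMeasure]
  infer_instance

lemma columnAngularMeasure_ne_zero {N : Seminorm ℝ (Fin d → ℝ)} (hN : IsNorm N)
    {A : Matrix (Fin d) (Fin d) ℝ≥0} (hA : A ≠ 0) {α : ℝ} (hα : 0 < α) :
    columnAngularMeasure N A α ≠ 0 := by
  intro h
  apply hA
  refine Matrix.ext fun i j => ?_
  have h1 := congrArg (fun μ => μ Set.univ) h
  simp only [columnAngularMeasure_eq_sum N A hα, Measure.finsetSum_apply, Measure.coe_zero,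
    Pi.zero_apply, Finset.sum_eq_zero_iff, Finset.mem_univ, true_implies] at h1
  have h2 := h1 j
  unfold columnDirac at h2
  split_ifs at h2 with h3
  · exact congrFun ((posNorm_eq_zero hN).1 h3) i
  · rw [Measure.smul_apply, measure_univ, ENNReal.smul_def, smul_eq_mul, mul_one,
      ENNReal.coe_eq_zero, NNReal.rpow_eq_zero_iff] at h2
    exact absurd h2.1 h3

lemma polarTest_smul_of_pos {N : Seminorm ℝ (Fin d → ℝ)} (f : PosExt × PosSphere N → ℝ)
    (θ : PosSphere N) {x : ℝ≥0} (hx : 0 < x) : polarTest f (x • θ.1) = f (toPosExt x, θ) := by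
  have h1 : posNorm N θ.1 = 1 := θ.2
  rw [polarTest, inv_smul_smul_direction hx.ne', posNorm_smul, h1, mul_one, inv_one, one_smul,
    ← (Subtype.val_injective.prodMap Subtype.val_injective).extend_apply f 0 (toPosExt x, θ)]
  simp [toPosExt, hx]

/-- Along the ray of a unit vector `θ` the polar test function is `f (x, θ)`. Replacing `θ` by `a_j
= ‖a_j‖ θ` rescales `x`, and homogeneity of the power measure produces the weight `‖a_j‖ ^ α`. -/
lemma integral_prod_columnAngularMeasure {N : Seminorm ℝ (Fin d → ℝ)} (hN : IsNorm N)
    (A : Matrix (Fin d) (Fin d) ℝ≥0) {α : ℝ} (hα : 0 < α) {f : PosExt × PosSphere N → ℝ}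
    (hf : Continuous f) (hfc : HasCompactSupport f) :
    ∫ p, f p ∂((powerMeasure α).prod (columnAngularMeasure N A α)) =
      ∑ j, ∫ x, polarTest f (x • fun i => A i j) ∂(tailMeasure α) := by
  obtain ⟨C, hC0, hC⟩ := exists_abs_le_of_hasCompactSupport hf hfc
  have hcont := continuous_polarTest hN hf hfc
  have hfm : ∀ θ : PosSphere N, Measurable fun x => f (toPosExt x, θ) := fun θ =>
    hf.measurable.comp (measurable_toPosExt.prodMk measurable_const)
  have hae : ∀ θ : PosSphere N,
      (fun x => polarTest f (x • θ.1)) =ᵐ[tailMeasure α] fun x => f (toPosExt x, θ) := fun θ => by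
    filter_upwards [ae_pos_tailMeasure α] with x hx using polarTest_smul_of_pos f θ hx
  have hint : ∀ θ : PosSphere N, Integrable (fun x => f (toPosExt x, θ)) (tailMeasure α) :=
    fun θ => (integrable_tailMeasure_of_eventually_zero hα
      (hcont.measurable.comp (by fun_prop)) (fun x => abs_polarTest_le hC0 hC _)
      ((tendsto_smul_zero_nnreal θ.1).eventually (eventually_polarTest_eq_zero hfc))).congr (hae θ)
  have hprod : ∀ θ : PosSphere N, (powerMeasure α).prod (Measure.dirac θ) =
      (tailMeasure α).map fun x => (toPosExt x, θ) := fun θ => by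
    rw [Measure.prod_dirac, powerMeasure_eq_map, Measure.map_map (by fun_prop) measurable_toPosExt]
    rfl
  have hmap : ∀ θ : PosSphere N, AEMeasurable (fun x => (toPosExt x, θ)) (tailMeasure α) :=
    fun θ => (measurable_toPosExt.prodMk measurable_const).aemeasurable
  rw [columnAngularMeasure_eq_sum N A hα, ← Measure.sum_fintype, Measure.prod_sum_right,
    Measure.sum_fintype, integral_finsetSum_measure]
  · refine Finset.sum_congr rfl fun j _ => ?_
    unfold columnDirac
    split_ifs with h
    · have : (fun i => A i j) = 0 := (posNorm_eq_zero hN).1 h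
      rw [this]
      simp [(eventually_polarTest_eq_zero hfc).self_of_nhds]
    · set θ : PosSphere N := ⟨_, posNorm_inv_smul h⟩ with hθ
      rw [Measure.prod_smul_right, integral_smul_nnreal_measure, hprod,
        integral_map (hmap θ) hf.aestronglyMeasurable, ← integral_congr_ae (hae θ),
        NNReal.smul_def, smul_eq_mul, NNReal.coe_rpow,
        ← integral_tailMeasure_comp_mul hα (g := fun x => polarTest f (x • θ.1))
          (hcont.measurable.comp (by fun_prop)) (pos_iff_ne_zero.2 h)]
      congr 1
      ext x
      rw [hθ, smul_smul, mul_right_comm, mul_inv_cancel₀ h, one_mul]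
  · intro j _
    unfold columnDirac
    split_ifs with h
    · simp
    · rw [Measure.prod_smul_right, hprod]
      refine Integrable.smul_measure_nnreal ?_
      rw [integrable_map_measure hf.aestronglyMeasurable (hmap _)]
      exact hint _

end Angular

/-! ### Uniqueness of the angular measure -/

section Uniqueness

/-- A continuous function on `(0, ∞]` that vanishes on `(0, 1]` and equals `1` on `[2, ∞]`. -/
noncomputable def ramp (r : PosExt) : ℝ := (min (r.1 - 1) 1).toReal

lemma continuous_ramp : Continuous ramp := by
  refine ENNReal.continuousOn_toReal.comp_continuous (f := fun r : PosExt => min (r.1 - 1) 1) ?_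
    fun r => ?_
  · exact ((ENNReal.continuous_sub_right 1).comp continuous_subtype_val).min continuous_const
  · exact ((min_le_right _ _).trans_lt ENNReal.one_lt_top).ne

lemma ramp_nonneg (r : PosExt) : 0 ≤ ramp r := ENNReal.toReal_nonneg

lemma ramp_le_one (r : PosExt) : ramp r ≤ 1 :=
  ENNReal.toReal_mono ENNReal.one_ne_top (min_le_right _ _)

lemma ramp_eq_zero {r : PosExt} (hr : r.1 ≤ 1) : ramp r = 0 := by
  simp [ramp, tsub_eq_zero_of_le hr]

lemma ramp_eq_one {r : PosExt} (hr : 2 ≤ r.1) : ramp r = 1 := by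
  have : 1 ≤ r.1 - 1 := by
    refine le_trans ?_ (tsub_le_tsub_right hr 1)
    rw [← one_add_one_eq_two, ENNReal.add_sub_cancel_right ENNReal.one_ne_top]
  simp [ramp, min_eq_right this]

lemma isCompact_posExt_ge_one : IsCompact {r : PosExt | 1 ≤ r.1} := by
  rw [IsEmbedding.subtypeVal.isCompact_iff]
  convert! (isCompact_Icc : IsCompact (Set.Icc (1 : ℝ≥0∞) ⊤))
  ext r
  constructor
  · rintro ⟨r, hr, rfl⟩; exact ⟨hr, le_top⟩
  · rintro ⟨hr, -⟩; exact ⟨⟨r, one_pos.trans_le hr⟩, hr, rfl⟩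

/-- The ramp dominates the indicator of `(2, ∞)`, which has mass `2 ^ (-α)`. -/
lemma integral_ramp_pos {α : ℝ} (hα : 0 < α) : 0 < ∫ r, ramp r ∂(powerMeasure α) := by
  rw [powerMeasure_eq_map, integral_map measurable_toPosExt.aemeasurable
    continuous_ramp.aestronglyMeasurable]
  have hm : Measurable fun x => ramp (toPosExt x) :=
    continuous_ramp.measurable.comp measurable_toPosExt
  have hI : Integrable (fun x => ramp (toPosExt x)) (tailMeasure α) := by
    refine integrable_tailMeasure_of_eventually_zero hα hm (C := 1) (fun x => ?_) ?_
    · rw [abs_of_nonneg (ramp_nonneg _)]; exact ramp_le_one _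
    · filter_upwards [Iio_mem_nhds (show (0 : ℝ≥0) < 1 from one_pos)] with x hx
      apply ramp_eq_zero
      simp only [toPosExt]
      -- The default value `1` of `toPosExt` at `0` is also a zero of the ramp.
      split_ifs
      · exact_mod_cast (le_of_lt hx : x ≤ 1)
      · exact le_rfl
  have h2 : (0 : ℝ) < ∫ x, (Set.Ioi (2 : ℝ≥0)).indicator 1 x ∂(tailMeasure α) := by
    rw [integral_indicator_one measurableSet_Ioi, tailMeasure_real_Ioi hα two_pos]
    positivity
  refine h2.trans_le (integral_mono ?_ hI fun x => ?_)
  · exact (integrable_indicator_iff measurableSet_Ioi).2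
      (integrableOn_const (tailMeasure_Ioi_ne_top hα two_pos))
  · by_cases hx : 2 < x
    · rw [Set.indicator_of_mem (Set.mem_Ioi.2 hx), ramp_eq_one, Pi.one_apply]
      simp only [toPosExt, two_pos.trans hx, if_true]
      exact_mod_cast hx.le
    · rw [Set.indicator_of_notMem (by simpa using hx)]; exact ramp_nonneg _

/-- The angular part of a product with the power measure is determined by the integrals of the
continuous compactly supported functions. -/
lemma eq_of_vagueTendsto_prod {N : Seminorm ℝ (Fin d → ℝ)} (hN : IsNorm N) {α : ℝ} (hα : 0 < α)
    {μ : ℕ → Measure (PosExt × PosSphere N)} {H H' : Measure (PosSphere N)} [IsFiniteMeasure H]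
    [IsFiniteMeasure H'] (h : VagueTendsto μ ((powerMeasure α).prod H))
    (h' : VagueTendsto μ ((powerMeasure α).prod H')) : H = H' := by
  have := compactSpace_posSphere hN
  refine ext_of_forall_integral_eq_of_IsFiniteMeasure fun g => ?_
  -- Products of the ramp with `g` have compact support, since `[1, ∞]` and the sphere are compact.
  -- Their integrals factor, and the positive radial factor cancels.
  have hc : Continuous fun p : PosExt × PosSphere N => ramp p.1 * g p.2 :=
    (continuous_ramp.comp continuous_fst).mul (g.continuous.comp continuous_snd)
  have hs : HasCompactSupport fun p : PosExt × PosSphere N => ramp p.1 * g p.2 := by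
    refine HasCompactSupport.intro (isCompact_posExt_ge_one.prod isCompact_univ) fun p hp => ?_
    have : ¬ 1 ≤ p.1.1 := fun h => hp ⟨h, trivial⟩
    rw [ramp_eq_zero (not_le.1 this).le, zero_mul]
  have key := tendsto_nhds_unique (h _ hc hs) (h' _ hc hs)
  rw [integral_prod_mul, integral_prod_mul] at key
  exact mul_left_cancel₀ (integral_ramp_pos hα).ne' key

end Uniqueness

/-! ### Assembly -/

lemma tendsto_rpow_one_div_atTop {α : ℝ} (hα : 0 < α) :
    Tendsto (fun n : ℕ => (n : ℝ≥0) ^ (1 / α)) atTop atTop := by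
  rw [← NNReal.tendsto_coe_atTop]
  simpa [Function.comp_def] using (tendsto_rpow_atTop (show 0 < 1 / α by positivity)).comp
    tendsto_natCast_atTop_atTop

/-- The angular measure of a linear transformation of a standardised vector with independent
components. -/
lemma hasAngularMeasure_mulVec {Ω : Type*} [MeasurableSpace Ω] {P : Measure Ω}
    [IsProbabilityMeasure P] {α : ℝ} (hα : 0 < α) {Z : Ω → Fin d → ℝ≥0} (hZ : Measurable Z)
    (hind : iIndepFun (fun i ω => Z ω i) P) (hstd : IsStandardised P Z α)
    (A : Matrix (Fin d) (Fin d) ℝ≥0) {N : Seminorm ℝ (Fin d → ℝ)} (hN : IsNorm N) :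
    HasAngularMeasure P N (fun ω => A *ᵥ Z ω) α (fun n => (n : ℝ≥0) ^ (1 / α))
      (columnAngularMeasure N A α) := by
  have hX : Measurable fun ω => A *ᵥ Z ω :=
    (show Continuous fun z : Fin d → ℝ≥0 => A *ᵥ z by fun_prop).measurable.comp hZ
  refine ⟨tendsto_rpow_one_div_atTop hα, isFiniteMeasure_columnAngularMeasure N A α,
    ⟨columnExponentMeasure A α, ⟨isFiniteMeasureOnCompacts_columnExponentMeasure A hα,
      fun f hf hfc => ?_⟩, fun C hC => columnAngularMeasure_eq_outerCone N A hα hC⟩,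
    fun f hf hfc => ?_⟩
  · obtain ⟨C, hC0, hC⟩ := exists_abs_le_of_hasCompactSupport hf hfc
    rw [integral_columnExponentMeasure A hα hf hfc]
    simp only [integral_scaledLaw hX _ _ hf]
    exact tendsto_integral_mulVec hα hZ hind hstd A (continuous_cartesianTest hf hfc)
      (abs_cartesianTest_le hC0 hC) (eventually_cartesianTest_eq_zero hfc)
  · obtain ⟨C, hC0, hC⟩ := exists_abs_le_of_hasCompactSupport hf hfc
    rw [integral_prod_columnAngularMeasure hN A hα hf hfc]
    refine (tendsto_integral_mulVec hα hZ hind hstd A (continuous_polarTest hN hf hfc)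
      (abs_polarTest_le hC0 hC) (eventually_polarTest_eq_zero hfc)).congr' ?_
    -- At `n = 0` the normalising constant is `0`, which `integral_scaledPolarLaw` excludes.
    filter_upwards [eventually_gt_atTop 0] with n hn
    rw [integral_scaledPolarLaw N hX _ hf]
    exact (NNReal.rpow_pos (by exact_mod_cast hn)).ne'

end MRV

theorem mainTheorem4 {Ω : Type*} [MeasurableSpace Ω] (P : Measure Ω) [IsProbabilityMeasure P]
    {d : ℕ} (A : Matrix (Fin d) (Fin d) ℝ≥0) (α : ℝ) (Z : Ω → Fin d → ℝ≥0)
    (hZ_meas : Measurable Z)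
    (hZ_rv : MRV.IsRegularlyVarying P Z α)
    (hZ_indep : iIndepFun (fun (i : Fin d) (ω : Ω) => Z ω i) P)
    (hZ_std : MRV.IsStandardised P Z α) :
    (A ≠ 0 → MRV.IsRegularlyVarying P (fun ω => A *ᵥ Z ω) α) ∧
    ∀ N : Seminorm ℝ (Fin d → ℝ), MRV.IsNorm N →
      MRV.HasAngularMeasure P N (fun ω => A *ᵥ Z ω) α (fun n => (n : ℝ≥0) ^ (1 / α))
        (MRV.columnAngularMeasure N A α) ∧
      ∀ H : Measure (MRV.PosSphere N),
        MRV.HasAngularMeasure P N (fun ω => A *ᵥ Z ω) α (fun n => (n : ℝ≥0) ^ (1 / α)) H →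
          H = MRV.columnAngularMeasure N A α := by
  have hα := hZ_rv.1
  have key := fun (N : Seminorm ℝ (Fin d → ℝ)) (hN : MRV.IsNorm N) =>
    MRV.hasAngularMeasure_mulVec hα hZ_meas hZ_indep hZ_std A hN
  refine ⟨fun hA => ⟨hα, fun N hN => ⟨_, _, MRV.columnAngularMeasure_ne_zero hN hA hα,
    key N hN⟩⟩, fun N hN => ⟨key N hN, fun H hH => ?_⟩⟩
  have h1 := (key N hN).2.1
  have h2 := hH.2.1
  exact MRV.eq_of_vagueTendsto_prod hN hα hH.2.2.2 (key N hN).2.2.2
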